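/- For $z\in\mathbb{C}$ with $0<\operatorname{Re} z<1$ let $\hat\zeta(z):=\pi^{-z/2}\,\Gamma(z/2)\,\zeta(z)$ be the completed zeta function. Let $a,b\in(0,1)$ be arbitrary. Let $0\searrow 1$ denote the line of slope $-1$ through the point $a$ of the real axis, traversed from $e^{3\pi i/4}\infty$ (upper left) to $e^{-\pi i/4}\infty$ (lower right), and let $0\swarrow 1$ denote the line of slope $+1$ through the point $b$ of the real axis, traversed from $e^{\pi i/4}\infty$ (upper right) to $e^{-3\pi i/4}\infty$ (lower left). Powers of $w$ are taken with the principal branch, which is holomorphic along both lines. Put $$\hat\zeta_{\rm l}(z):=\pi^{-z/2}\,\Gamma\!\left(\tfrac z2\right)\int_{0\searrow 1}\frac{w^{-z}e^{-\pi i w^2}}{e^{\pi i w}-e^{-\pi i w}}\,dw,\qquad \hat\zeta_{\rm r}(z):=\pi^{-(1-z)/2}\,\Gamma\!\left(\tfrac{1-z}2\right)\int_{0\swarrow 1}\frac{w^{z-1}e^{\pi i w^2}}{e^{\pi i w}-e^{-\pi i w}}\,dw .$$ Then both integrals converge absolutely and $$\hat\zeta(z)=\hat\zeta_{\rm l}(z)+\hat\zeta_{\rm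 r}(z).$$ -/

import Mathlib

/-- The straight line through the real point `a` with direction `d`, traversed in the direction
of `d`. -/
noncomputable def linePath (d : ℂ) (a : ℝ) (t : ℝ) : ℂ := (a : ℂ) + (t : ℂ) * d

/-- The contour `0 ↘ 1` through the real point `a`: the line of slope `-1`, traversed from the
upper left to the lower right. -/
noncomputable def pathSE (a : ℝ) : ℝ → ℂ := linePath (1 - Complex.I) a

/-- The contour `0 ↙ 1` through the real point `a`: the line of slope `+1`, traversed from the
upper right to the lower left. -/
noncomputable def pathSW (a : ℝ) : ℝ → ℂ := linePath (-1 - Complex.I) a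

/-- The pulled-back form `f (γ t) γ'(t)`, for a path `γ` parametrised by the whole real line. -/
noncomputable def pullback (f : ℂ → ℂ) (γ : ℝ → ℂ) (t : ℝ) : ℂ := f (γ t) * deriv γ t

/-- Absolute convergence of the contour integral of `f` along `γ`. -/
def ContourIntegrable (f : ℂ → ℂ) (γ : ℝ → ℂ) : Prop :=
  MeasureTheory.Integrable (pullback f γ)

/-- The contour integral `∫_γ f(w) dw` along a path `γ` parametrised by the whole real line. -/
noncomputable def contourIntegral (f : ℂ → ℂ) (γ : ℝ → ℂ) : ℂ := ∫ t : ℝ, pullback f γ t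

/-- `w^{-z} e^{-π i w²} / (e^{π i w} - e^{-π i w})`, with the principal branch of the power
(holomorphic on every contour used, none of which meets `(-∞, 0]`). -/
noncomputable def integrandL (z w : ℂ) : ℂ :=
  w ^ (-z) * Complex.exp (-(Real.pi * Complex.I * w ^ 2)) /
    (Complex.exp (Real.pi * Complex.I * w) - Complex.exp (-(Real.pi * Complex.I * w)))

/-- `w^{z-1} e^{π i w²} / (e^{π i w} - e^{-π i w})`, with the principal branch of the power. -/
noncomputable def integrandR (z w : ℂ) : ℂ :=
  w ^ (z - 1) * Complex.exp (Real.pi * Complex.I * w ^ 2) /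
    (Complex.exp (Real.pi * Complex.I * w) - Complex.exp (-(Real.pi * Complex.I * w)))

/-- The completed zeta function `π^{-z/2} Γ(z/2) ζ(z)`. -/
noncomputable def completedZeta (z : ℂ) : ℂ :=
  (Real.pi : ℂ) ^ (-z / 2) * Complex.Gamma (z / 2) * riemannZeta z

/-- The first term, with the contour `0 ↘ 1` crossing the real axis at `a`. -/
noncomputable def zetaL (a : ℝ) (z : ℂ) : ℂ :=
  (Real.pi : ℂ) ^ (-z / 2) * Complex.Gamma (z / 2) * contourIntegral (integrandL z) (pathSE a)

/-- The second term, with the contour `0 ↙ 1` crossing the real axis at `b`. -/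
noncomputable def zetaR (b : ℝ) (z : ℂ) : ℂ :=
  (Real.pi : ℂ) ^ (-(1 - z) / 2) * Complex.Gamma ((1 - z) / 2) *
    contourIntegral (integrandR z) (pathSW b)

open Complex Filter Topology MeasureTheory Set

/-! The engine is Mordell's integral `G(u) = ∫ e^{2πiuw - πiw²} / (e^{πiw} - e^{-πiw}) dw` along the
contour `0 ↘ 1`. It satisfies two linear relations between `G(u)` and `G(u-1)`: subtracting the
integrands cancels the denominator and leaves a Gaussian (`mordellIntegral_sub_mordellIntegral`),
while translating the contour by `1` crosses the pole `w = 1` (`mordellIntegral_sub_exp_mul`).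
Eliminating `G(u-1)` gives the closed form `mordellIntegral_eq`.

Put `u = (1+i)r` and take the Mellin transform in `r > 0`, for `Re z > 2`. Fubini and a Gamma
integral turn `G` into the left contour integral, the summand `1/(e^{-2πiu} - 1)` gives `ζ(z)`, and
the other summand gives an integral over the ray through `1+i` (`mellin_decomposition`). For the
same `z` the right contour can be pushed to the origin, where it splits into two rays, both
multiples of that ray integral (`contourIntegral_integrandR_eq`, `integral_rotatedIntegrandR`).

The resulting relation between `ζ` and the two contour integrals continues analytically to `z ≠ 1`
(`contourIntegral_relation`). In the critical strip, Gamma-function identities put it in the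
symmetric form. -/

/-! ### Cauchy's theorem and a residue formula for horizontal lines. -/

theorem tendsto_intervalIntegral_sub_of_strip {h : ℂ → ℂ} {y₁ y₂ : ℝ} (hy : y₁ ≤ y₂)
    (hc : ContinuousOn h {ζ | ζ.im ∈ Icc y₁ y₂})
    (hd : ∀ ζ : ℂ, ζ.im ∈ Ioo y₁ y₂ → DifferentiableAt ℂ h ζ)
    (hB : ∀ ε > 0, ∃ T₀ : ℝ, ∀ t : ℝ, T₀ ≤ |t| → ∀ y ∈ Icc y₁ y₂, ‖h (t + y * I)‖ ≤ ε) :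
    Tendsto (fun T : ℝ => (∫ x in -T..T, h (x + y₁ * I)) - ∫ x in -T..T, h (x + y₂ * I))
      atTop (𝓝 0) := by
  have key : ∀ T : ℝ, 0 ≤ T → (∫ x in -T..T, h (x + y₁ * I)) - (∫ x in -T..T, h (x + y₂ * I)) =
      I • (∫ y in y₁..y₂, h (((-T : ℝ) : ℂ) + y * I)) - I • ∫ y in y₁..y₂, h (T + y * I) := by
    intro T hT
    have := Complex.integral_boundary_rect_eq_zero_of_differentiable_on_off_countable h
      (⟨-T, y₁⟩ : ℂ) (⟨T, y₂⟩ : ℂ) ∅ countable_empty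
      (hc.mono fun ζ hζ => by simpa [uIcc_of_le hy] using hζ.2)
      (fun ζ hζ => hd ζ (by simpa [hy] using hζ.1.2))
    simp only at this
    linear_combination this
  rw [Metric.tendsto_atTop]
  intro ε hε
  obtain ⟨T₀, hT₀⟩ := hB (ε / (4 * (1 + |y₂ - y₁|))) (by positivity)
  refine ⟨max T₀ 0, fun T hT => ?_⟩
  have hT0 : 0 ≤ T := le_trans (le_max_right _ _) hT
  have hT1 : T₀ ≤ T := le_trans (le_max_left _ _) hT
  have side : ∀ t : ℝ, |t| = T → ‖I • ∫ y in y₁..y₂, h (t + y * I)‖ ≤ ε / 4 := by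
    intro t ht
    rw [norm_smul, norm_I, one_mul]
    refine (intervalIntegral.norm_integral_le_of_norm_le_const
      (C := ε / (4 * (1 + |y₂ - y₁|))) fun y hy' => ?_).trans ?_
    · rw [uIoc_of_le hy] at hy'
      exact hT₀ t (ht ▸ hT1) y ⟨hy'.1.le, hy'.2⟩
    · rw [div_mul_eq_mul_div, div_le_div_iff₀ (by positivity) (by norm_num)]
      nlinarith [abs_nonneg (y₂ - y₁)]
  rw [dist_zero_right, key T hT0]
  have h1 := side T (abs_of_nonneg hT0)
  have h2 := side (-T) (by rw [abs_neg, abs_of_nonneg hT0])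
  linarith [norm_sub_le (I • ∫ y in y₁..y₂, h (((-T : ℝ) : ℂ) + y * I))
    (I • ∫ y in y₁..y₂, h (T + y * I))]

theorem tendsto_symm_intervalIntegral {f : ℝ → ℂ} (hf : Integrable f) :
    Tendsto (fun T : ℝ => ∫ x in -T..T, f x) atTop (𝓝 (∫ x, f x)) :=
  intervalIntegral_tendsto_integral hf tendsto_neg_atTop_atBot tendsto_id

theorem integral_eq_of_strip {h : ℂ → ℂ} {y₁ y₂ : ℝ} (hy : y₁ ≤ y₂)
    (hc : ContinuousOn h {ζ | ζ.im ∈ Icc y₁ y₂})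
    (hd : ∀ ζ : ℂ, ζ.im ∈ Ioo y₁ y₂ → DifferentiableAt ℂ h ζ)
    (hB : ∀ ε > 0, ∃ T₀ : ℝ, ∀ t : ℝ, T₀ ≤ |t| → ∀ y ∈ Icc y₁ y₂, ‖h (t + y * I)‖ ≤ ε)
    (h₁ : Integrable fun x : ℝ => h (x + y₁ * I)) (h₂ : Integrable fun x : ℝ => h (x + y₂ * I)) :
    ∫ x : ℝ, h (x + y₁ * I) = ∫ x : ℝ, h (x + y₂ * I) :=
  sub_eq_zero.mp <| tendsto_nhds_unique
    ((tendsto_symm_intervalIntegral h₁).sub (tendsto_symm_intervalIntegral h₂))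
    (tendsto_intervalIntegral_sub_of_strip hy hc hd hB)

theorem tendsto_log_add_sub_log_add (a b : ℂ) :
    Tendsto (fun T : ℝ => log (T + a) - log (T + b)) atTop (𝓝 0) := by
  have h : ∀ a : ℂ, Tendsto (fun T : ℝ => 1 + a / (T : ℂ)) atTop (𝓝 1) := by
    intro a
    have : Tendsto (fun T : ℝ => a * ((T⁻¹ : ℝ) : ℂ)) atTop (𝓝 (a * ((0 : ℝ) : ℂ))) :=
      (continuous_ofReal.continuousAt.tendsto.comp tendsto_inv_atTop_zero).const_mul a
    simpa [div_eq_mul_inv] using this.const_add 1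
  have h' : ∀ a : ℂ, Tendsto (fun T : ℝ => log (1 + a / (T : ℂ))) atTop (𝓝 0) := by
    intro a
    simpa [Function.comp_def] using
      (continuousAt_clog (by simp : (1 : ℂ) ∈ slitPlane)).tendsto.comp (h a)
  have := (h' a).sub (h' b)
  rw [sub_zero] at this
  refine this.congr' ?_
  filter_upwards [eventually_gt_atTop 0, (h a).eventually_ne one_ne_zero,
    (h b).eventually_ne one_ne_zero] with T hT ha hb
  have hT' : (T : ℂ) ≠ 0 := ofReal_ne_zero.mpr hT.ne'
  have e : ∀ a : ℂ, (T : ℂ) + a = T * (1 + a / T) := fun a => by field_simp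
  rw [e a, e b, log_ofReal_mul hT ha, log_ofReal_mul hT hb]
  ring

theorem intervalIntegral_inv_add (T : ℝ) {c : ℂ} (hc : c.im ≠ 0) :
    ∫ t in -T..T, ((t : ℂ) + c)⁻¹ = log (T + c) - log (((-T : ℝ) : ℂ) + c) := by
  have hs : ∀ t : ℝ, (t : ℂ) + c ∈ slitPlane := fun t => Or.inr (by simpa using hc)
  refine intervalIntegral.integral_eq_sub_of_hasDerivAt (f := fun t : ℝ => log (t + c))
    (fun t _ => ?_) ?_
  · simpa using ((hasDerivAt_id (t : ℂ)).add_const c).comp_ofReal.clog_real (hs t)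
  · refine Continuous.intervalIntegrable ?_ _ _
    exact Continuous.inv₀ (by fun_prop) fun t => slitPlane_ne_zero (hs t)

theorem log_neg_of_im_neg {x : ℂ} (hx : x.im < 0) : log (-x) = log x + Real.pi * I := by
  rw [log, log, norm_neg, arg_neg_eq_arg_add_pi_of_im_neg hx]
  push_cast; ring

theorem log_neg_of_im_pos {x : ℂ} (hx : 0 < x.im) : log (-x) = log x - Real.pi * I := by
  rw [log, log, norm_neg, arg_neg_eq_arg_sub_pi_of_im_pos hx]
  push_cast; ring

/-- With `log (t + c)` as primitive, the moduli at the two ends cancel in the limit and only a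
half-turn of the argument survives; its sign depends on the side of the pole on which the line runs.
-/
theorem tendsto_intervalIntegral_inv_add_of_im_pos {c : ℂ} (hc : 0 < c.im) :
    Tendsto (fun T : ℝ => ∫ t in -T..T, ((t : ℂ) + c)⁻¹) atTop (𝓝 (-(Real.pi * I))) := by
  have := (tendsto_log_add_sub_log_add c (-c)).sub_const (Real.pi * I)
  rw [zero_sub] at this
  refine this.congr fun T => ?_
  rw [intervalIntegral_inv_add T hc.ne',
    show ((-T : ℝ) : ℂ) + c = -(T + -c) by push_cast; ring,
    log_neg_of_im_neg (by simpa using hc)]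
  ring

theorem tendsto_intervalIntegral_inv_add_of_im_neg {c : ℂ} (hc : c.im < 0) :
    Tendsto (fun T : ℝ => ∫ t in -T..T, ((t : ℂ) + c)⁻¹) atTop (𝓝 (Real.pi * I)) := by
  have := (tendsto_log_add_sub_log_add c (-c)).add_const (Real.pi * I)
  rw [zero_add] at this
  refine this.congr fun T => ?_
  rw [intervalIntegral_inv_add T hc.ne,
    show ((-T : ℝ) : ℂ) + c = -(T + -c) by push_cast; ring,
    log_neg_of_im_pos (by simpa using hc)]
  ring

/-- Subtracting `N p / (ζ - p)` leaves the holomorphic `dslope N p`, to which Cauchy's theorem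
applies. The subtracted term is not absolutely integrable on a line, so symmetric truncations are
used; its limits `πi` below and `-πi` above the pole produce the `2πi`. -/
theorem integral_sub_integral_eq_residue {N : ℂ → ℂ} {U : Set ℂ} (hU : IsOpen U)
    (hN : DifferentiableOn ℂ N U) {y₁ y₂ : ℝ} {p : ℂ} (hp₁ : y₁ < p.im) (hp₂ : p.im < y₂)
    (hsub : {ζ : ℂ | ζ.im ∈ Icc y₁ y₂} ⊆ U)
    (hB : ∀ ε > 0, ∃ T₀ : ℝ, ∀ t : ℝ, T₀ ≤ |t| → ∀ y ∈ Icc y₁ y₂,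
      ‖N (t + y * I) / (t + y * I - p)‖ ≤ ε)
    (h₁ : Integrable fun x : ℝ => N (x + y₁ * I) / (x + y₁ * I - p))
    (h₂ : Integrable fun x : ℝ => N (x + y₂ * I) / (x + y₂ * I - p)) :
    (∫ x : ℝ, N (x + y₁ * I) / (x + y₁ * I - p)) -
      (∫ x : ℝ, N (x + y₂ * I) / (x + y₂ * I - p)) = 2 * Real.pi * I * N p := by
  have hpU : U ∈ 𝓝 p := hU.mem_nhds (hsub ⟨hp₁.le, hp₂.le⟩)
  have hD : DifferentiableOn ℂ (dslope N p) U := (differentiableOn_dslope hpU).mpr hN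
  have hval : ∀ ζ : ℂ, ζ ≠ p → dslope N p ζ = N ζ / (ζ - p) - N p * (ζ - p)⁻¹ := by
    intro ζ hζ
    rw [dslope_of_ne _ hζ, slope_def_field]
    ring
  have hne : ∀ y : ℝ, y ≠ p.im → ∀ x : ℝ, (x : ℂ) + y * I ≠ p := by
    rintro y hy x rfl
    simp at hy
  have hlim := tendsto_intervalIntegral_sub_of_strip (h := dslope N p) (hp₁.trans hp₂).le
    (hD.continuousOn.mono hsub)
    (fun ζ hζ => hD.differentiableAt (hU.mem_nhds (hsub ⟨hζ.1.le, hζ.2.le⟩))) ?_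
  · have hI : ∀ (y : ℝ), y ≠ p.im → ∀ T : ℝ,
        Integrable (fun x : ℝ => N (x + y * I) / (x + y * I - p)) →
        ∫ x in -T..T, dslope N p (x + y * I) = (∫ x in -T..T, N (x + y * I) / (x + y * I - p)) -
          N p * ∫ x in -T..T, ((x : ℂ) + (y * I - p))⁻¹ := by
      intro y hy T hint
      rw [← intervalIntegral.integral_const_mul, ← intervalIntegral.integral_sub]
      · refine intervalIntegral.integral_congr fun x _ => ?_
        simp only [hval _ (hne y hy x), add_sub_assoc]
      · exact hint.intervalIntegrable
      · refine Continuous.intervalIntegrable ?_ _ _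
        refine continuous_const.mul (Continuous.inv₀ (by fun_prop) fun x => ?_)
        rw [← add_sub_assoc]
        exact sub_ne_zero.mpr (hne y hy x)
    have hlim' := ((tendsto_symm_intervalIntegral h₁).sub
      ((tendsto_intervalIntegral_inv_add_of_im_neg (c := y₁ * I - p) (by simpa)).const_mul
        (N p))).sub ((tendsto_symm_intervalIntegral h₂).sub
      ((tendsto_intervalIntegral_inv_add_of_im_pos (c := y₂ * I - p) (by simpa)).const_mul (N p)))
    have := tendsto_nhds_unique hlim (hlim'.congr fun T => by
      rw [hI y₁ hp₁.ne T h₁, hI y₂ hp₂.ne' T h₂])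
    linear_combination -this
  · intro ε hε
    obtain ⟨T₀, hT₀⟩ := hB (ε / 2) (by positivity)
    -- The second bound forces `‖t + yi - p‖ ≥ 1 + 2‖N p‖/ε`, so the subtracted pole term is at most
    -- `ε / 2`.
    refine ⟨max T₀ (|p.re| + 1 + 2 * ‖N p‖ / ε), fun t ht y hy => ?_⟩
    have ht1 := (le_max_right _ _).trans ht
    have hpos : 0 ≤ 2 * ‖N p‖ / ε := by positivity
    have hre : |t| - |p.re| ≤ ‖(t : ℂ) + y * I - p‖ := by
      refine le_trans ?_ (abs_re_le_norm _)
      simpa using abs_sub_abs_le_abs_sub t p.re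
    have hlow : 1 + 2 * ‖N p‖ / ε ≤ ‖(t : ℂ) + y * I - p‖ := by linarith
    have hne' : (t : ℂ) + y * I ≠ p := by
      rintro h
      rw [h, sub_self, norm_zero] at hlow
      linarith
    rw [hval _ hne']
    refine (norm_sub_le _ _).trans ?_
    have h2 : ‖N p * ((t : ℂ) + y * I - p)⁻¹‖ ≤ ε / 2 := by
      rw [norm_mul, norm_inv, ← div_eq_mul_inv, div_le_iff₀ (by linarith)]
      have : ε / 2 * (1 + 2 * ‖N p‖ / ε) = ε / 2 + ‖N p‖ := by field_simp
      nlinarith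
    linarith [hT₀ t ((le_max_left _ _).trans ht) y hy]

/-! ### Convergence of the contour integrals and holomorphy in `z`. -/

/-- The functions `A e^{B|t| - 2πt²}` serve as majorants throughout: the Gaussian factor supplies
`-2πt²` on lines of slope `±1`, and powers, logarithms and exponentials linear in `w` only enlarge
`A` and `B`. -/
theorem exp_abs_sub_le (B t : ℝ) :
    Real.exp (B * |t| - 2 * Real.pi * t ^ 2) ≤ Real.exp (B ^ 2) * Real.exp (-1 * t ^ 2) := by
  rw [← Real.exp_add, Real.exp_le_exp]
  nlinarith [sq_nonneg (2 * |t| - B), sq_abs t, Real.pi_gt_three, sq_nonneg t, sq_nonneg B]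

theorem integrable_exp_abs_sub (B : ℝ) :
    Integrable fun t : ℝ => Real.exp (B * |t| - 2 * Real.pi * t ^ 2) := by
  refine ((integrable_exp_neg_mul_sq one_pos).const_mul (Real.exp (B ^ 2))).mono'
    (Continuous.aestronglyMeasurable (by fun_prop)) (ae_of_all _ fun t => ?_)
  rw [Real.norm_of_nonneg (Real.exp_pos _).le]
  exact exp_abs_sub_le B t

theorem tendsto_exp_abs_sub (A B : ℝ) :
    Tendsto (fun t : ℝ => A * Real.exp (B * t - 2 * Real.pi * t ^ 2)) atTop (𝓝 0) := by
  have h : Tendsto (fun t : ℝ => (2 * Real.pi * t - B) * t) atTop atTop := by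
    refine Tendsto.atTop_mul_atTop₀ ?_ tendsto_id
    exact tendsto_atTop_add_const_right _ _ (tendsto_id.const_mul_atTop (by positivity))
  have := (Real.tendsto_exp_neg_atTop_nhds_zero.comp h).const_mul A
  rw [mul_zero] at this
  refine this.congr fun t => ?_
  simp only [Function.comp]
  congr 2
  ring

/-- The denominator `e^{π i w} - e^{-π i w}` of both integrands. -/
noncomputable def expDiff (w : ℂ) : ℂ :=
  exp (Real.pi * I * w) - exp (-(Real.pi * I * w))

theorem differentiable_expDiff : Differentiable ℂ expDiff := by
  unfold expDiff
  fun_prop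

theorem expDiff_eq_zero_iff {w : ℂ} : expDiff w = 0 ↔ ∃ n : ℤ, w = n := by
  rw [expDiff, sub_eq_zero, exp_eq_exp_iff_exists_int]
  have hpi : (Real.pi : ℂ) * I ≠ 0 := by simp [Real.pi_ne_zero]
  refine exists_congr fun n => ⟨fun h => ?_, fun h => ?_⟩
  · have : (Real.pi : ℂ) * I * (2 * (w - n)) = 0 := by linear_combination h
    have := (mul_eq_zero.mp this).resolve_left hpi
    linear_combination this / 2
  · rw [h]; ring

/-- The two exponentials have norms `e^{∓π Im w}`, one of which is at most `1` and the other at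
least `1 + π|Im w|`. Hence `1 / expDiff` is bounded by `1` once `|Im w| ≥ 1`. -/
theorem abs_im_le_norm_expDiff (w : ℂ) : |w.im| ≤ ‖expDiff w‖ := by
  have h := abs_norm_sub_norm_le (exp (Real.pi * I * w)) (exp (-(Real.pi * I * w)))
  refine le_trans ?_ h
  rw [norm_exp, norm_exp]
  have h1 : (Real.pi * I * w).re = -(Real.pi * w.im) := by simp
  rw [neg_re, h1, neg_neg]
  have hpi := Real.pi_gt_three
  rcases le_total 0 w.im with hw | hw
  · have h2 := Real.add_one_le_exp (Real.pi * w.im)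
    have h3 : Real.exp (-(Real.pi * w.im)) ≤ 1 := Real.exp_le_one_iff.mpr (by nlinarith)
    rw [abs_of_nonneg hw, abs_sub_comm]
    refine le_trans ?_ (le_abs_self _)
    nlinarith
  · have h2 := Real.add_one_le_exp (-(Real.pi * w.im))
    have h3 : Real.exp (Real.pi * w.im) ≤ 1 := Real.exp_le_one_iff.mpr (by nlinarith)
    rw [abs_of_nonpos hw]
    refine le_trans ?_ (le_abs_self _)
    nlinarith

theorem exists_forall_norm_le_of_one_le_abs {E : Type*} [NormedAddCommGroup E] {f : ℝ → E}
    (hf : Continuous f) {g : ℝ → ℝ} (hg : ∀ t, 0 ≤ g t) (h : ∀ t, 1 ≤ |t| → ‖f t‖ ≤ g t) :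
    ∃ C, 0 ≤ C ∧ ∀ t, ‖f t‖ ≤ C + g t := by
  obtain ⟨C, hC⟩ := (isCompact_Icc (a := (-1 : ℝ)) (b := 1)).exists_bound_of_continuousOn
    hf.continuousOn
  refine ⟨max C 0, le_max_right _ _, fun t => ?_⟩
  rcases le_total 1 |t| with ht | ht
  · linarith [h t ht, le_max_right C 0]
  · linarith [hC t (abs_le.mp ht), le_max_left C 0, hg t]

theorem exists_norm_inv_expDiff_le {γ : ℝ → ℂ} (hγ : Continuous γ) (hne : ∀ t, expDiff (γ t) ≠ 0)
    (him : ∀ t, |t| ≤ |(γ t).im|) : ∃ C, 0 ≤ C ∧ ∀ t, ‖(expDiff (γ t))⁻¹‖ ≤ C := by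
  obtain ⟨C, hC0, hC⟩ := exists_forall_norm_le_of_one_le_abs (f := fun t => (expDiff (γ t))⁻¹)
    ((differentiable_expDiff.continuous.comp hγ).inv₀ hne) (g := fun _ => 1)
    (fun _ => zero_le_one) fun t ht => by
      rw [norm_inv]
      exact inv_le_one_of_one_le₀ (ht.trans ((him t).trans (abs_im_le_norm_expDiff _)))
  exact ⟨C + 1, by positivity, hC⟩

theorem norm_log_le_of_one_le_norm {w : ℂ} (hw : 1 ≤ ‖w‖) : ‖log w‖ ≤ ‖w‖ + Real.pi := by
  refine (norm_le_abs_re_add_abs_im _).trans ?_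
  rw [log_re, log_im, abs_of_nonneg (Real.log_nonneg hw)]
  exact add_le_add (Real.log_le_self (norm_nonneg _)) (abs_arg_le_pi _)

theorem exists_norm_log_le {γ : ℝ → ℂ} (hγ : Continuous γ) (hs : ∀ t, γ t ∈ slitPlane)
    (him : ∀ t, |t| ≤ |(γ t).im|) {c : ℝ} (hc : 0 ≤ c) (hn : ∀ t, ‖γ t‖ ≤ c + 2 * |t|) :
    ∃ C, 0 ≤ C ∧ ∀ t, ‖log (γ t)‖ ≤ C + 2 * |t| := by
  obtain ⟨C, hC0, hC⟩ := exists_forall_norm_le_of_one_le_abs (f := fun t => log (γ t))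
    (hγ.clog hs) (g := fun t => c + 2 * |t| + Real.pi) (fun _ => by positivity) fun t ht =>
      (norm_log_le_of_one_le_norm (ht.trans ((him t).trans (abs_im_le_norm _)))).trans
        (by linarith [hn t])
  exact ⟨C + c + Real.pi, by positivity, fun t => by linarith [hC t]⟩

theorem norm_cpow_le_exp {w : ℂ} (hw : w ≠ 0) (s : ℂ) :
    ‖w ^ s‖ ≤ Real.exp (‖log w‖ * ‖s‖) := by
  rw [cpow_def_of_ne_zero hw, norm_exp, ← norm_mul]
  exact Real.exp_le_exp.mpr (re_le_norm _)

section cpowIntegral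

variable {γ k : ℝ → ℂ}

theorem exists_norm_cpow_mul_le (hs : ∀ t, γ t ∈ slitPlane)
    (hlog : ∃ C, 0 ≤ C ∧ ∀ t, ‖log (γ t)‖ ≤ C + 2 * |t|)
    (hkb : ∃ A B, 0 ≤ A ∧ ∀ t, ‖k t‖ ≤ A * Real.exp (B * |t| - 2 * Real.pi * t ^ 2)) (R : ℝ) :
    ∃ A B, 0 ≤ A ∧ ∀ s : ℂ, ‖s‖ ≤ R → ∀ t,
      ‖γ t ^ s * k t‖ ≤ A * Real.exp (B * |t| - 2 * Real.pi * t ^ 2) := by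
  obtain ⟨C, hC0, hC⟩ := hlog
  obtain ⟨A, B, hA, hk⟩ := hkb
  refine ⟨Real.exp (C * R) * A, 2 * R + B, by positivity, fun s hsR t => ?_⟩
  have h1 : ‖γ t ^ s‖ ≤ Real.exp ((C + 2 * |t|) * R) :=
    (norm_cpow_le_exp (slitPlane_ne_zero (hs t)) s).trans (Real.exp_le_exp.mpr
      (mul_le_mul (hC t) hsR (norm_nonneg _) (by positivity)))
  rw [norm_mul]
  refine (mul_le_mul h1 (hk t) (norm_nonneg _) (Real.exp_pos _).le).trans_eq ?_
  rw [mul_left_comm, ← Real.exp_add, mul_comm (Real.exp _) A, mul_assoc A,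
      ← Real.exp_add]
  ring_nf

theorem integrable_cpow_mul (hγ : Continuous γ) (hk : Continuous k) (hs : ∀ t, γ t ∈ slitPlane)
    (hlog : ∃ C, 0 ≤ C ∧ ∀ t, ‖log (γ t)‖ ≤ C + 2 * |t|)
    (hkb : ∃ A B, 0 ≤ A ∧ ∀ t, ‖k t‖ ≤ A * Real.exp (B * |t| - 2 * Real.pi * t ^ 2)) (s : ℂ) :
    Integrable fun t => γ t ^ s * k t := by
  obtain ⟨A, B, -, h⟩ := exists_norm_cpow_mul_le hs hlog hkb ‖s‖
  refine ((integrable_exp_abs_sub B).const_mul A).mono' ?_ (ae_of_all _ (h s le_rfl))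
  exact ((hγ.cpow continuous_const hs).mul hk).aestronglyMeasurable

theorem differentiable_integral_cpow_mul (hγ : Continuous γ) (hk : Continuous k)
    (hs : ∀ t, γ t ∈ slitPlane)
    (hlog : ∃ C, 0 ≤ C ∧ ∀ t, ‖log (γ t)‖ ≤ C + 2 * |t|)
    (hkb : ∃ A B, 0 ≤ A ∧ ∀ t, ‖k t‖ ≤ A * Real.exp (B * |t| - 2 * Real.pi * t ^ 2)) :
    Differentiable ℂ fun s : ℂ => ∫ t, γ t ^ s * k t := by
  intro s₀
  obtain ⟨C, hC0, hC⟩ := hlog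
  have hk' : ∃ A B, 0 ≤ A ∧ ∀ t, ‖log (γ t) * k t‖ ≤
      A * Real.exp (B * |t| - 2 * Real.pi * t ^ 2) := by
    obtain ⟨A, B, hA, hb⟩ := hkb
    refine ⟨Real.exp C * A, 2 + B, by positivity, fun t => ?_⟩
    rw [norm_mul]
    have h1 : ‖log (γ t)‖ ≤ Real.exp (C + 2 * |t|) :=
      (hC t).trans (by linarith [Real.add_one_le_exp (C + 2 * |t|)])
    refine (mul_le_mul h1 (hb t) (norm_nonneg _) (Real.exp_pos _).le).trans_eq ?_
    rw [mul_left_comm, ← Real.exp_add, mul_comm (Real.exp _) A, mul_assoc A,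
      ← Real.exp_add]
    ring_nf
  -- The radius covers the unit ball about `s₀`, so one majorant dominates the `s`-derivative for
  -- all nearby `s`.
  obtain ⟨A, B, hA, hb⟩ := exists_norm_cpow_mul_le hs ⟨C, hC0, hC⟩ hk' (‖s₀‖ + 1)
  refine (hasDerivAt_integral_of_dominated_loc_of_deriv_le (s := Metric.ball s₀ 1)
    (bound := fun t => A * Real.exp (B * |t| - 2 * Real.pi * t ^ 2))
    (F := fun s t => γ t ^ s * k t) (F' := fun s t => γ t ^ s * (log (γ t) * k t))
    (Metric.ball_mem_nhds _ one_pos)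
    (Eventually.of_forall fun s =>
      ((hγ.cpow continuous_const hs).mul hk).aestronglyMeasurable)
    (integrable_cpow_mul hγ hk hs ⟨C, hC0, hC⟩ hkb s₀)
    ((hγ.cpow continuous_const hs).mul ((hγ.clog hs).mul hk)).aestronglyMeasurable
    (ae_of_all _ fun t s hst => hb s ?_ t)
    ((integrable_exp_abs_sub B).const_mul A) (ae_of_all _ fun t s _ => ?_)).2.differentiableAt
  · have : ‖s - s₀‖ < 1 := by simpa [dist_eq_norm] using hst
    linarith [norm_sub_norm_le s s₀]
  · rw [← mul_assoc]
    simpa using ((hasDerivAt_id s).const_cpow (Or.inl (slitPlane_ne_zero (hs t)))).mul_const (k t)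

end cpowIntegral

section linePath

variable {d : ℂ} {a : ℝ}

theorem continuous_linePath (d : ℂ) (a : ℝ) : Continuous (linePath d a) := by
  unfold linePath
  fun_prop

theorem deriv_linePath (d : ℂ) (a t : ℝ) : deriv (linePath d a) t = d := by
  have : HasDerivAt (linePath d a) (1 * d) t :=
    ((hasDerivAt_id (t : ℂ)).comp_ofReal.mul_const d).const_add (a : ℂ)
  rw [this.deriv, one_mul]

theorem linePath_im (hd : d.im = -1) (t : ℝ) : (linePath d a t).im = -t := by
  simp [linePath, hd]

theorem linePath_zero : linePath d a 0 = a := by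
  simp [linePath]

theorem linePath_mem_slitPlane (hd : d.im = -1) (ha : 0 < a) (t : ℝ) :
    linePath d a t ∈ slitPlane := by
  rcases eq_or_ne t 0 with rfl | ht
  · simp [linePath_zero, ha]
  · exact Or.inr (by simpa [linePath_im hd] using ht)

theorem expDiff_linePath_ne_zero (hd : d.im = -1) (ha : a ∈ Ioo (0 : ℝ) 1) (t : ℝ) :
    expDiff (linePath d a t) ≠ 0 := by
  rw [Ne, expDiff_eq_zero_iff]
  rintro ⟨n, hn⟩
  have him := congrArg im hn
  rw [linePath_im hd, intCast_im, neg_eq_zero] at him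
  rw [him, linePath_zero] at hn
  have hn' : a = n := by exact_mod_cast hn
  have h0 : (0 : ℝ) < n := hn' ▸ ha.1
  have h1 : (n : ℝ) < 1 := hn' ▸ ha.2
  have h0' : 0 < n := by exact_mod_cast h0
  have h1' : n < 1 := by exact_mod_cast h1
  omega

theorem abs_le_abs_linePath_im (hd : d.im = -1) (t : ℝ) : |t| ≤ |(linePath d a t).im| := by
  rw [linePath_im hd, abs_neg]

theorem norm_linePath_le (hd : ‖d‖ ≤ 2) (t : ℝ) : ‖linePath d a t‖ ≤ |a| + 2 * |t| := by
  refine (norm_add_le _ _).trans ?_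
  rw [norm_mul, norm_real, norm_real, Real.norm_eq_abs, Real.norm_eq_abs]
  nlinarith [abs_nonneg t]

theorem exists_norm_log_linePath_le (hd : d.im = -1) (hd2 : ‖d‖ ≤ 2) (ha : 0 < a) :
    ∃ C, 0 ≤ C ∧ ∀ t, ‖log (linePath d a t)‖ ≤ C + 2 * |t| :=
  exists_norm_log_le (continuous_linePath d a) (linePath_mem_slitPlane hd ha)
    (abs_le_abs_linePath_im hd) (abs_nonneg a) (norm_linePath_le hd2)

theorem exists_norm_inv_expDiff_linePath_le (hd : d.im = -1) (ha : a ∈ Ioo (0 : ℝ) 1) :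
    ∃ C, 0 ≤ C ∧ ∀ t, ‖(expDiff (linePath d a t))⁻¹‖ ≤ C :=
  exists_norm_inv_expDiff_le (continuous_linePath d a) (expDiff_linePath_ne_zero hd ha)
    (abs_le_abs_linePath_im hd)

end linePath

theorem norm_one_sub_I_le : ‖1 - I‖ ≤ 2 :=
  (norm_sub_le _ _).trans (by rw [norm_one, norm_I]; norm_num)

theorem norm_neg_one_sub_I_le : ‖-1 - I‖ ≤ 2 :=
  (norm_sub_le _ _).trans (by rw [norm_neg, norm_one, norm_I]; norm_num)

theorem norm_exp_linePath_one_sub_I (a t : ℝ) :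
    ‖exp (-(Real.pi * I * linePath (1 - I) a t ^ 2))‖ ≤
      Real.exp (2 * Real.pi * |a| * |t| - 2 * Real.pi * t ^ 2) := by
  rw [norm_exp, Real.exp_le_exp]
  have : (-(Real.pi * I * linePath (1 - I) a t ^ 2)).re =
      -(2 * Real.pi * (a * t)) - 2 * Real.pi * t ^ 2 := by
    simp [linePath, pow_two]
    ring
  rw [this, mul_assoc (2 * Real.pi), ← abs_mul]
  nlinarith [neg_abs_le (a * t), Real.pi_pos]

theorem norm_exp_linePath_neg_one_sub_I (a t : ℝ) :
    ‖exp (Real.pi * I * linePath (-1 - I) a t ^ 2)‖ ≤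
      Real.exp (2 * Real.pi * |a| * |t| - 2 * Real.pi * t ^ 2) := by
  rw [norm_exp, Real.exp_le_exp]
  have : (Real.pi * I * linePath (-1 - I) a t ^ 2).re =
      2 * Real.pi * (a * t) - 2 * Real.pi * t ^ 2 := by
    simp [linePath, pow_two]
    ring
  rw [this, mul_assoc (2 * Real.pi), ← abs_mul]
  nlinarith [le_abs_self (a * t), Real.pi_pos]

/-- The kernel of `integrandL` pulled back to `pathSE a`, without the power of `w`. -/
noncomputable def kernelL (a t : ℝ) : ℂ :=
  exp (-(Real.pi * I * pathSE a t ^ 2)) / expDiff (pathSE a t) * (1 - I)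

/-- The kernel of `integrandR` pulled back to `pathSW b`, without the power of `w`. -/
noncomputable def kernelR (b t : ℝ) : ℂ :=
  exp (Real.pi * I * pathSW b t ^ 2) / expDiff (pathSW b t) * (-1 - I)

theorem pullback_integrandL (z : ℂ) (a t : ℝ) :
    pullback (integrandL z) (pathSE a) t = pathSE a t ^ (-z) * kernelL a t := by
  rw [pullback, integrandL, kernelL, expDiff, pathSE, deriv_linePath]
  ring

theorem pullback_integrandR (z : ℂ) (b t : ℝ) :
    pullback (integrandR z) (pathSW b) t = pathSW b t ^ (z - 1) * kernelR b t := by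
  rw [pullback, integrandR, kernelR, expDiff, pathSW, deriv_linePath]
  ring

theorem continuous_kernelL {a : ℝ} (ha : a ∈ Ioo (0 : ℝ) 1) : Continuous (kernelL a) := by
  have h1 : Continuous (pathSE a) := continuous_linePath _ a
  refine (Continuous.div (by fun_prop) (differentiable_expDiff.continuous.comp h1)
    (expDiff_linePath_ne_zero (by simp) ha)).mul continuous_const

theorem continuous_kernelR {a : ℝ} (ha : a ∈ Ioo (0 : ℝ) 1) : Continuous (kernelR a) := by
  have h1 : Continuous (pathSW a) := continuous_linePath _ a
  refine (Continuous.div (by fun_prop) (differentiable_expDiff.continuous.comp h1)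
    (expDiff_linePath_ne_zero (by simp) ha)).mul continuous_const

theorem exists_norm_kernelL_le {a : ℝ} (ha : a ∈ Ioo (0 : ℝ) 1) :
    ∃ A B, 0 ≤ A ∧ ∀ t, ‖kernelL a t‖ ≤ A * Real.exp (B * |t| - 2 * Real.pi * t ^ 2) := by
  obtain ⟨C, hC0, hC⟩ := exists_norm_inv_expDiff_linePath_le (d := 1 - I) (by simp) ha
  refine ⟨C * 2, 2 * Real.pi * |a|, by positivity, fun t => ?_⟩
  rw [kernelL, div_eq_mul_inv, norm_mul, norm_mul]
  refine (mul_le_mul (mul_le_mul (norm_exp_linePath_one_sub_I a t) (hC t) (norm_nonneg _)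
    (Real.exp_pos _).le) norm_one_sub_I_le (norm_nonneg _) (by positivity)).trans_eq ?_
  ring

theorem exists_norm_kernelR_le {a : ℝ} (ha : a ∈ Ioo (0 : ℝ) 1) :
    ∃ A B, 0 ≤ A ∧ ∀ t, ‖kernelR a t‖ ≤ A * Real.exp (B * |t| - 2 * Real.pi * t ^ 2) := by
  obtain ⟨C, hC0, hC⟩ := exists_norm_inv_expDiff_linePath_le (d := -1 - I) (by simp) ha
  refine ⟨C * 2, 2 * Real.pi * |a|, by positivity, fun t => ?_⟩
  rw [kernelR, div_eq_mul_inv, norm_mul, norm_mul]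
  refine (mul_le_mul (mul_le_mul (norm_exp_linePath_neg_one_sub_I a t) (hC t) (norm_nonneg _)
    (Real.exp_pos _).le) norm_neg_one_sub_I_le (norm_nonneg _) (by positivity)).trans_eq ?_
  ring

theorem contourIntegrable_integrandL {a : ℝ} (ha : a ∈ Ioo (0 : ℝ) 1) (z : ℂ) :
    ContourIntegrable (integrandL z) (pathSE a) := by
  refine (integrable_cpow_mul (continuous_linePath _ a) (continuous_kernelL ha)
    (linePath_mem_slitPlane (by simp) ha.1)
    (exists_norm_log_linePath_le (by simp) norm_one_sub_I_le ha.1)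
    (exists_norm_kernelL_le ha) (-z)).congr (ae_of_all _ fun t => ?_)
  exact (pullback_integrandL z a t).symm

theorem contourIntegrable_integrandR {a : ℝ} (ha : a ∈ Ioo (0 : ℝ) 1) (z : ℂ) :
    ContourIntegrable (integrandR z) (pathSW a) := by
  refine (integrable_cpow_mul (continuous_linePath _ a) (continuous_kernelR ha)
    (linePath_mem_slitPlane (by simp) ha.1)
    (exists_norm_log_linePath_le (by simp) norm_neg_one_sub_I_le ha.1)
    (exists_norm_kernelR_le ha) (z - 1)).congr (ae_of_all _ fun t => ?_)
  exact (pullback_integrandR z a t).symm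

theorem differentiable_contourIntegral_integrandL {a : ℝ} (ha : a ∈ Ioo (0 : ℝ) 1) :
    Differentiable ℂ fun z => contourIntegral (integrandL z) (pathSE a) := by
  have h := differentiable_integral_cpow_mul (continuous_linePath _ a) (continuous_kernelL ha)
    (linePath_mem_slitPlane (by simp) ha.1)
    (exists_norm_log_linePath_le (by simp) norm_one_sub_I_le ha.1) (exists_norm_kernelL_le ha)
  simp only [contourIntegral, pullback_integrandL]
  exact h.comp differentiable_neg

theorem differentiable_contourIntegral_integrandR {a : ℝ} (ha : a ∈ Ioo (0 : ℝ) 1) :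
    Differentiable ℂ fun z => contourIntegral (integrandR z) (pathSW a) := by
  have h := differentiable_integral_cpow_mul (continuous_linePath _ a) (continuous_kernelR ha)
    (linePath_mem_slitPlane (by simp) ha.1)
    (exists_norm_log_linePath_le (by simp) norm_neg_one_sub_I_le ha.1) (exists_norm_kernelR_le ha)
  simp only [contourIntegral, pullback_integrandR]
  exact h.comp (differentiable_id.sub_const 1)

/-! ### Evaluation of the Mordell integral from two functional equations. -/

/-- The Mordell integral `∫ e^{2π i u w - π i w²} / (e^{π i w} - e^{-π i w}) dw` along
`pathSE a`. -/
noncomputable def mordellIntegral (a : ℝ) (u : ℂ) : ℂ :=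
  ∫ t : ℝ, exp (2 * Real.pi * I * u * pathSE a t) * kernelL a t

theorem integrable_exp_mul_kernelL {a : ℝ} (ha : a ∈ Ioo (0 : ℝ) 1) (u : ℂ) :
    Integrable fun t : ℝ => exp (2 * Real.pi * I * u * pathSE a t) * kernelL a t := by
  obtain ⟨A, B, hA, hk⟩ := exists_norm_kernelL_le ha
  have h1 : Continuous (pathSE a) := continuous_linePath _ a
  refine ((integrable_exp_abs_sub (‖2 * Real.pi * I * u‖ * 2 + B)).const_mul
    (Real.exp (‖2 * Real.pi * I * u‖ * |a|) * A)).mono' ?_ (ae_of_all _ fun t => ?_)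
  · exact (Continuous.mul (by fun_prop) (continuous_kernelL ha)).aestronglyMeasurable
  · have h2 : ‖exp (2 * Real.pi * I * u * pathSE a t)‖ ≤
        Real.exp (‖2 * Real.pi * I * u‖ * (|a| + 2 * |t|)) := by
      rw [norm_exp, Real.exp_le_exp]
      refine (re_le_norm _).trans ?_
      rw [norm_mul]
      exact mul_le_mul_of_nonneg_left (norm_linePath_le norm_one_sub_I_le t) (norm_nonneg _)
    rw [norm_mul]
    refine (mul_le_mul h2 (hk t) (norm_nonneg _) (Real.exp_pos _).le).trans_eq ?_
    rw [mul_left_comm, ← Real.exp_add, mul_comm (Real.exp _) A, mul_assoc A,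
      ← Real.exp_add]
    ring_nf

/-- Since `e^{2πiuw} - e^{2πi(u-1)w} = e^{2πi(u-1/2)w} (e^{πiw} - e^{-πiw})`, the denominator
cancels and a complete Gaussian integral remains. -/
theorem mordellIntegral_sub_mordellIntegral {a : ℝ} (ha : a ∈ Ioo (0 : ℝ) 1) (u : ℂ) :
    mordellIntegral a u - mordellIntegral a (u - 1) =
      exp (Real.pi * I * u ^ 2 - Real.pi * I * u) := by
  rw [mordellIntegral, mordellIntegral, ← integral_sub (integrable_exp_mul_kernelL ha u)
    (integrable_exp_mul_kernelL ha (u - 1))]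
  have hpt : ∀ t : ℝ, exp (2 * Real.pi * I * u * pathSE a t) * kernelL a t -
      exp (2 * Real.pi * I * (u - 1) * pathSE a t) * kernelL a t =
      (1 - I) * exp (-(2 * Real.pi) * (t : ℂ) ^ 2 +
        ((2 * Real.pi * I * (u - 1 / 2) - 2 * Real.pi * I * a) * (1 - I)) * t +
        (2 * Real.pi * I * (u - 1 / 2) * a - Real.pi * I * a ^ 2)) := by
    intro t
    have hne : expDiff (pathSE a t) ≠ 0 := expDiff_linePath_ne_zero (by simp) ha t
    have e1 : exp (2 * Real.pi * I * u * pathSE a t) -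
        exp (2 * Real.pi * I * (u - 1) * pathSE a t) =
        exp (2 * Real.pi * I * (u - 1 / 2) * pathSE a t) * expDiff (pathSE a t) := by
      rw [expDiff, mul_sub (exp _), ← exp_add, ← exp_add]
      ring_nf
    rw [← sub_mul, e1, kernelL, show ∀ x y e c : ℂ, x * e * (y / e * c) = c * (x * y) * (e * e⁻¹)
      from fun _ _ _ _ => by ring, mul_inv_cancel₀ hne, mul_one, ← exp_add]
    congr 2
    rw [pathSE, linePath]
    linear_combination (-(Real.pi : ℂ) * I * t ^ 2 + 2 * Real.pi * t ^ 2) * I_sq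
  simp_rw [hpt]
  have hpi : (Real.pi : ℂ) ≠ 0 := ofReal_ne_zero.mpr Real.pi_ne_zero
  -- The direction `1 - i = √2 e^{-πi/4}`, the Gaussian normalisation `√(π/2π)` and the phase
  -- `e^{πi/4}` left by completing the square cancel.
  have hconst : (1 - I) * (1 / 2 : ℂ) ^ (1 / 2 : ℂ) * exp (Real.pi / 4 * I) = 1 := by
    have h1 : (1 / 2 : ℂ) ^ (1 / 2 : ℂ) = ((√(1 / 2) : ℝ) : ℂ) := by
      rw [Real.sqrt_eq_rpow, ofReal_cpow (by norm_num)]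
      norm_num
    have h2 : (√(1 / 2) : ℝ) * √2 = 1 := by
      rw [← Real.sqrt_mul (by norm_num)]
      norm_num
    have h3 : ((√(1 / 2) : ℝ) : ℂ) * ((√2 : ℝ) : ℂ) = 1 := by exact_mod_cast h2
    have h4 : exp (Real.pi / 4 * I) = ((√2 : ℝ) : ℂ) / 2 * (1 + I) := by
      rw [exp_mul_I, show (Real.pi : ℂ) / 4 = ((Real.pi / 4 : ℝ) : ℂ) by push_cast; rfl,
        ← ofReal_cos, ← ofReal_sin, Real.cos_pi_div_four, Real.sin_pi_div_four]
      push_cast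
      ring
    rw [h1, h4]
    linear_combination h3 - ((√(1 / 2) : ℝ) : ℂ) * ((√2 : ℝ) : ℂ) / 2 * I_sq
  rw [integral_const_mul, integral_cexp_quadratic (by simp [Real.pi_pos]),
    show (Real.pi : ℂ) / -(-(2 * Real.pi)) = 1 / 2 by field_simp]
  have hexp : 2 * Real.pi * I * (u - 1 / 2) * a - Real.pi * I * a ^ 2 -
      ((2 * Real.pi * I * (u - 1 / 2) - 2 * Real.pi * I * a) * (1 - I)) ^ 2 /
        (4 * -(2 * (Real.pi : ℂ))) =
      Real.pi / 4 * I + (Real.pi * I * u ^ 2 - Real.pi * I * u) := by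
    have : ((2 * Real.pi * I * (u - 1 / 2) - 2 * Real.pi * I * a) * (1 - I)) ^ 2 =
        8 * Real.pi ^ 2 * I * (u - 1 / 2 - a) ^ 2 := by
      linear_combination (4 * Real.pi ^ 2 * (u - 1 / 2 - a) ^ 2 * (I ^ 2 - 2 * I)) * I_sq
    rw [this]
    field_simp
    ring
  rw [hexp, exp_add]
  linear_combination exp (Real.pi * I * u ^ 2 - Real.pi * I * u) * hconst

theorem exists_forall_exp_abs_sub_le (A B T₁ : ℝ) {ε : ℝ} (hε : 0 < ε) :
    ∃ T₀, T₁ ≤ T₀ ∧ ∀ t : ℝ, T₀ ≤ |t| → A * Real.exp (B * |t| - 2 * Real.pi * t ^ 2) ≤ ε := by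
  obtain ⟨T, hT⟩ := eventually_atTop.mp ((tendsto_exp_abs_sub A B).eventually_le_const hε)
  refine ⟨max T T₁, le_max_right _ _, fun t ht => ?_⟩
  simpa using hT |t| ((le_max_left _ _).trans ht)

theorem norm_exp_neg_two_pi_sq_le {t y : ℝ} (hy0 : 0 ≤ y) (hy1 : y ≤ 1) :
    ‖exp (-(2 * Real.pi) * ((t : ℂ) + y * I) ^ 2)‖ ≤
      Real.exp (2 * Real.pi) * Real.exp (-(2 * Real.pi * t ^ 2)) := by
  rw [norm_exp, ← Real.exp_add, Real.exp_le_exp]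
  have : (-(2 * Real.pi) * ((t : ℂ) + y * I) ^ 2).re =
      2 * Real.pi * y ^ 2 - 2 * Real.pi * t ^ 2 := by
    simp [pow_two]
    ring
  rw [this]
  nlinarith [Real.pi_pos, mul_le_one₀ hy1 hy0 hy1]

theorem norm_mul_add_mul_I_le {d : ℂ} (hd : ‖d‖ ≤ 2) {t y : ℝ} (hy0 : 0 ≤ y) (hy1 : y ≤ 1) :
    ‖d * ((t : ℂ) + y * I)‖ ≤ 2 * (|t| + 1) := by
  rw [norm_mul]
  refine mul_le_mul hd ((norm_add_le _ _).trans ?_) (norm_nonneg _) zero_le_two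
  rw [norm_mul, norm_I, norm_real, norm_real, Real.norm_eq_abs, Real.norm_eq_abs,
    abs_of_nonneg hy0]
  linarith

theorem expDiff_eq_sub_mul_dslope {c : ℂ} (hc : expDiff c = 0) (w : ℂ) :
    expDiff w = (w - c) * dslope expDiff c w := by
  simpa [hc] using (sub_smul_dslope expDiff c w).symm

theorem differentiable_dslope_expDiff (c : ℂ) : Differentiable ℂ (dslope expDiff c) :=
  differentiableOn_univ.mp
    ((differentiableOn_dslope univ_mem).mpr differentiable_expDiff.differentiableOn)

theorem expDiff_intCast (n : ℤ) : expDiff n = 0 := expDiff_eq_zero_iff.mpr ⟨n, rfl⟩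

theorem deriv_expDiff (w : ℂ) : deriv expDiff w =
    Real.pi * I * (exp (Real.pi * I * w) + exp (-(Real.pi * I * w))) := by
  have h : HasDerivAt (fun w : ℂ => Real.pi * I * w) (Real.pi * I * 1) w :=
    (hasDerivAt_id w).const_mul _
  have : HasDerivAt expDiff _ w := h.cexp.sub h.neg.cexp
  rw [this.deriv]
  simp only [Pi.neg_apply]
  ring

theorem deriv_expDiff_one : deriv expDiff 1 = -(2 * Real.pi * I) := by
  rw [deriv_expDiff, mul_one, exp_pi_mul_I, exp_neg_pi_mul_I]
  ring

theorem deriv_expDiff_zero : deriv expDiff 0 = 2 * Real.pi * I := by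
  rw [deriv_expDiff]
  simp
  ring

theorem expDiff_add_one (w : ℂ) : expDiff (w + 1) = -expDiff w := by
  rw [expDiff, expDiff, mul_add, neg_add, exp_add, exp_add, mul_one, exp_pi_mul_I,
    exp_neg_pi_mul_I]
  ring

theorem expDiff_neg (w : ℂ) : expDiff (-w) = -expDiff w := by
  rw [expDiff, expDiff, mul_neg, neg_neg]
  ring

/-- The only integer in the closed strip between the contours through `a` and `a + 1` is `1`, and
the zero there is simple. -/
theorem dslope_expDiff_one_ne_zero {w : ℂ} {a : ℝ} (ha : a ∈ Ioo (0 : ℝ) 1)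
    (h : w.re + w.im ∈ Icc a (a + 1)) : dslope expDiff 1 w ≠ 0 := by
  intro h0
  rcases eq_or_ne w 1 with rfl | hw
  · rw [dslope_same, deriv_expDiff_one] at h0
    simp [Real.pi_ne_zero] at h0
  · have h1 := expDiff_eq_sub_mul_dslope (by simpa using expDiff_intCast 1) w
    rw [h0, mul_zero, expDiff_eq_zero_iff] at h1
    obtain ⟨n, rfl⟩ := h1
    simp only [intCast_re, intCast_im, add_zero] at h
    have h2 : (0 : ℝ) < n := ha.1.trans_le h.1
    have h3 : (n : ℝ) < 2 := by linarith [h.2, ha.2]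
    have h2' : 0 < n := by exact_mod_cast h2
    have h3' : n < 2 := by exact_mod_cast h3
    have : n = 1 := by omega
    simp [this] at hw

/-- The integrand of the Mordell integral, as a function on the plane rotated by `1 - I`. -/
noncomputable def mordellIntegrand (u ζ : ℂ) : ℂ :=
  exp (2 * Real.pi * I * u * ((1 - I) * ζ)) * exp (-(2 * Real.pi) * ζ ^ 2) /
    expDiff ((1 - I) * ζ) * (1 - I)

/-- Multiplication by `1 - i` carries the horizontal line at height `a/2` to the slanted contour,
which makes Cauchy's theorem on axis-parallel rectangles available. -/
theorem pathSE_eq (a t : ℝ) :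
    pathSE a t = (1 - I) * (((t + a / 2 : ℝ) : ℂ) + ((a / 2 : ℝ) : ℂ) * I) := by
  rw [pathSE, linePath]
  push_cast
  linear_combination (a / 2 : ℂ) * I_sq

theorem mordellIntegrand_add_half (u : ℂ) (a t : ℝ) :
    mordellIntegrand u (((t + a / 2 : ℝ) : ℂ) + ((a / 2 : ℝ) : ℂ) * I) =
      exp (2 * Real.pi * I * u * pathSE a t) * kernelL a t := by
  rw [mordellIntegrand, kernelL, ← pathSE_eq, show -(2 * Real.pi) *
    (((t + a / 2 : ℝ) : ℂ) + ((a / 2 : ℝ) : ℂ) * I) ^ 2 = -(Real.pi * I * pathSE a t ^ 2) by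
      rw [pathSE_eq]
      linear_combination (Real.pi * (((t + a / 2 : ℝ) : ℂ) + ((a / 2 : ℝ) : ℂ) * I) ^ 2 *
        (I - 2)) * I_sq]
  ring

theorem pathSE_add_one (a t : ℝ) : pathSE (a + 1) t = pathSE a t + 1 := by
  simp only [pathSE, linePath]
  push_cast
  ring

/-- Under `w ↦ w + 1` the Gaussian gains `-e^{-2πiw}`, which lowers `u` by `1`, and its sign cancels
against that of `expDiff`. -/
theorem exp_mul_kernelL_add_one (u : ℂ) (a t : ℝ) :
    exp (2 * Real.pi * I * u * pathSE (a + 1) t) * kernelL (a + 1) t =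
      exp (2 * Real.pi * I * u) * (exp (2 * Real.pi * I * (u - 1) * pathSE a t) * kernelL a t) := by
  rw [kernelL, kernelL, pathSE_add_one, expDiff_add_one]
  have h : exp (2 * Real.pi * I * u * (pathSE a t + 1)) *
      exp (-(Real.pi * I * (pathSE a t + 1) ^ 2)) =
      -(exp (2 * Real.pi * I * u) * (exp (2 * Real.pi * I * (u - 1) * pathSE a t) *
        exp (-(Real.pi * I * pathSE a t ^ 2)))) := by
    rw [← neg_one_mul (exp _ * _), ← exp_neg_pi_mul_I, ← exp_add, ← exp_add, ← exp_add, ← exp_add]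
    ring_nf
  rw [div_neg, neg_mul, mul_neg, ← mul_assoc, ← mul_div_assoc, h]
  ring

theorem integral_mordellIntegrand (u : ℂ) (a : ℝ) :
    ∫ t : ℝ, mordellIntegrand u (t + ((a / 2 : ℝ) : ℂ) * I) =
      ∫ t : ℝ, exp (2 * Real.pi * I * u * pathSE a t) * kernelL a t := by
  rw [← integral_add_right_eq_self _ (a / 2)]
  simp_rw [mordellIntegrand_add_half]

theorem integrable_mordellIntegrand {u : ℂ} {a : ℝ}
    (h : Integrable fun t : ℝ => exp (2 * Real.pi * I * u * pathSE a t) * kernelL a t) :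
    Integrable fun t : ℝ => mordellIntegrand u (t + ((a / 2 : ℝ) : ℂ) * I) := by
  refine (h.comp_add_right (-(a / 2))).congr (ae_of_all _ fun t => ?_)
  simp only [← mordellIntegrand_add_half, neg_add_cancel_right]

theorem exists_norm_mordellIntegrand_le (u : ℂ) :
    ∃ A B, ∀ t y : ℝ, 2 ≤ |t| → 0 ≤ y → y ≤ 1 →
      ‖mordellIntegrand u (t + y * I)‖ ≤ A * Real.exp (B * |t| - 2 * Real.pi * t ^ 2) := by
  refine ⟨Real.exp (‖2 * Real.pi * I * u‖ * 2) * Real.exp (2 * Real.pi) * 2,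
    ‖2 * Real.pi * I * u‖ * 2, fun t y ht hy0 hy1 => ?_⟩
  have h1 : ‖exp (2 * Real.pi * I * u * ((1 - I) * (t + y * I)))‖ ≤
      Real.exp (‖2 * Real.pi * I * u‖ * (2 * (|t| + 1))) := by
    rw [norm_exp, Real.exp_le_exp]
    refine (re_le_norm _).trans ?_
    rw [norm_mul]
    exact mul_le_mul_of_nonneg_left (norm_mul_add_mul_I_le norm_one_sub_I_le hy0 hy1)
      (norm_nonneg _)
  have h2 : ‖(expDiff ((1 - I) * (t + y * I)))⁻¹‖ ≤ 1 := by
    rw [norm_inv]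
    refine inv_le_one_of_one_le₀ (le_trans ?_ (abs_im_le_norm_expDiff _))
    have : ((1 - I) * ((t : ℂ) + y * I)).im = y - t := by simp; ring
    rw [this, abs_sub_comm]
    have := abs_sub_abs_le_abs_sub t y
    rw [abs_of_nonneg hy0] at this
    linarith
  rw [mordellIntegrand, div_eq_mul_inv, norm_mul, norm_mul, norm_mul]
  refine (mul_le_mul (mul_le_mul (mul_le_mul h1 (norm_exp_neg_two_pi_sq_le hy0 hy1)
    (norm_nonneg _) (Real.exp_pos _).le) h2 (norm_nonneg _) (by positivity))
    norm_one_sub_I_le (norm_nonneg _) (by positivity)).trans_eq ?_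
  rw [show ‖2 * Real.pi * I * u‖ * (2 * (|t| + 1)) =
    ‖2 * Real.pi * I * u‖ * 2 + ‖2 * Real.pi * I * u‖ * 2 * |t| by ring, Real.exp_add,
    sub_eq_add_neg (_ * |t|), Real.exp_add]
  ring

/-- The second term is the same integral over the contour moved to `a + 1`, so the difference is the
residue contribution of the pole `w = 1`. -/
theorem mordellIntegral_sub_exp_mul {a : ℝ} (ha : a ∈ Ioo (0 : ℝ) 1) (u : ℂ) :
    mordellIntegral a u - exp (2 * Real.pi * I * u) * mordellIntegral a (u - 1) =
      exp (2 * Real.pi * I * u) := by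
  have hint₂ : Integrable fun t : ℝ =>
      exp (2 * Real.pi * I * u * pathSE (a + 1) t) * kernelL (a + 1) t := by
    simp only [exp_mul_kernelL_add_one]
    exact (integrable_exp_mul_kernelL ha (u - 1)).const_mul _
  have hG₂ : exp (2 * Real.pi * I * u) * mordellIntegral a (u - 1) =
      ∫ t : ℝ, mordellIntegrand u (t + (((a + 1) / 2 : ℝ) : ℂ) * I) := by
    rw [integral_mordellIntegrand, mordellIntegral, ← integral_const_mul]
    simp only [exp_mul_kernelL_add_one]
  rw [hG₂, mordellIntegral, ← integral_mordellIntegrand]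
  -- The preimage of `w = 1` under rotation by `1 - i`; its height `1/2` lies strictly between `a/2`
  -- and `(a+1)/2`.
  set p : ℂ := (1 + I) / 2 with hp
  have hpim : p.im = 1 / 2 := by simp [hp]
  set N : ℂ → ℂ := fun ζ => exp (2 * Real.pi * I * u * ((1 - I) * ζ)) *
    exp (-(2 * Real.pi) * ζ ^ 2) / dslope expDiff 1 ((1 - I) * ζ) with hN
  have hdc : (1 - I) * p = 1 := by
    rw [hp]
    linear_combination (-1 / 2 : ℂ) * I_sq
  have hd0 : (1 - I) ≠ 0 := left_ne_zero_of_mul_eq_one hdc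
  have hNg : ∀ ζ, mordellIntegrand u ζ = N ζ / (ζ - p) := by
    intro ζ
    have h1 := expDiff_eq_sub_mul_dslope (by simpa using expDiff_intCast 1) ((1 - I) * ζ)
    rw [show (1 - I) * ζ - 1 = (1 - I) * (ζ - p) by rw [mul_sub, hdc]] at h1
    simp only [mordellIntegrand, h1, hN]
    rw [div_div, div_mul_eq_mul_div, mul_comm _ (1 - I), mul_assoc (1 - I) (ζ - p),
      mul_div_mul_left _ _ hd0, mul_comm (ζ - p)]
  have hcont : Continuous fun ζ : ℂ => dslope expDiff 1 ((1 - I) * ζ) :=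
    (differentiable_dslope_expDiff 1).continuous.comp (by fun_prop)
  have hU : IsOpen {ζ : ℂ | dslope expDiff 1 ((1 - I) * ζ) ≠ 0} :=
    isOpen_ne_fun hcont continuous_const
  have hres := integral_sub_integral_eq_residue (N := N) (p := p) (y₁ := a / 2)
    (y₂ := (a + 1) / 2) hU ?_ (by linarith [ha.2]) (by linarith [ha.1]) ?_ ?_ ?_ ?_
  · simp only [← hNg] at hres
    rw [hres, hN]
    simp only [hdc]
    rw [dslope_same, deriv_expDiff_one, show -(2 * Real.pi) * p ^ 2 = -(Real.pi * I) by
      rw [hp]; linear_combination (-(Real.pi : ℂ) / 2) * I_sq, exp_neg_pi_mul_I, mul_one]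
    have : (Real.pi : ℂ) * I ≠ 0 := by simp [Real.pi_ne_zero]
    field_simp
  · refine DifferentiableOn.div (by fun_prop) ?_ fun ζ hζ => hζ
    exact ((differentiable_dslope_expDiff 1).comp (by fun_prop)).differentiableOn
  · intro ζ hζ
    refine dslope_expDiff_one_ne_zero ha ?_
    have : ((1 - I) * ζ).re + ((1 - I) * ζ).im = 2 * ζ.im := by simp; ring
    rw [this]
    constructor <;> linarith [hζ.1, hζ.2]
  · intro ε hε
    obtain ⟨A, B, hAB⟩ := exists_norm_mordellIntegrand_le u
    obtain ⟨T₀, hT₂, hT₀⟩ := exists_forall_exp_abs_sub_le A B 2 hε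
    refine ⟨T₀, fun t ht y hy => ?_⟩
    rw [← hNg]
    exact (hAB t y (hT₂.trans ht) (by linarith [hy.1, ha.1])
      (by linarith [hy.2, ha.2])).trans (hT₀ t ht)
  · simp only [← hNg]
    exact integrable_mordellIntegrand (integrable_exp_mul_kernelL ha u)
  · simp only [← hNg]
    exact integrable_mordellIntegrand hint₂

/-- Eliminating `G(u-1)` from the two functional equations leaves the factor `1 - q²` with `q =
e^{πiu}`, nonzero by `hu`. -/
theorem mordellIntegral_eq {a : ℝ} (ha : a ∈ Ioo (0 : ℝ) 1) {u : ℂ}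
    (hu : exp (2 * Real.pi * I * u) ≠ 1) :
    mordellIntegral a u = 1 / (exp (-(2 * Real.pi * I * u)) - 1) +
      exp (Real.pi * I * u ^ 2) / expDiff u := by
  have h1 := mordellIntegral_sub_mordellIntegral ha u
  have h2 := mordellIntegral_sub_exp_mul ha u
  set q := exp (Real.pi * I * u) with hq
  have hq0 : q ≠ 0 := exp_ne_zero _
  have e1 : exp (2 * Real.pi * I * u) = q ^ 2 := by rw [hq, ← exp_nat_mul]; ring_nf
  have e2 : exp (-(2 * Real.pi * I * u)) = (q ^ 2)⁻¹ := by rw [exp_neg, e1]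
  have e3 : expDiff u = q - q⁻¹ := by rw [expDiff, exp_neg]
  rw [e1] at hu h2
  have hne : 1 - q ^ 2 ≠ 0 := sub_ne_zero.mpr hu.symm
  have hne' : q ^ 2 - 1 ≠ 0 := sub_ne_zero.mpr hu
  rw [exp_sub, ← hq] at h1
  have key : mordellIntegral a u * (1 - q ^ 2) = q ^ 2 - exp (Real.pi * I * u ^ 2) * q := by
    have : exp (Real.pi * I * u ^ 2) / q * q ^ 2 = exp (Real.pi * I * u ^ 2) * q := by
      field_simp
    linear_combination h2 - q ^ 2 * h1 - this
  rw [e2, e3]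
  have h3 : (q ^ 2)⁻¹ - 1 = (1 - q ^ 2) / q ^ 2 := by field_simp
  have h4 : q - q⁻¹ = -(1 - q ^ 2) / q := by field_simp; ring
  rw [h3, h4, eq_div_of_mul_eq hne key]
  field_simp
  ring

/-! ### The right contour pushed to the origin, for `Re z > 2`. -/

theorem integrable_of_norm_le_exp_abs_sub {f : ℝ → ℂ} (hf : Continuous f) {A B T : ℝ}
    (hB : 0 ≤ B) (h : ∀ t, T ≤ |t| → ‖f t‖ ≤ A * Real.exp (B * |t| - 2 * Real.pi * t ^ 2)) :
    Integrable f := by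
  obtain ⟨C, hC⟩ := (isCompact_Icc (a := -T) (b := T)).exists_bound_of_continuousOn hf.continuousOn
  refine ((integrable_exp_abs_sub B).const_mul
    (|A| + |C| * Real.exp (2 * Real.pi * T ^ 2))).mono' hf.aestronglyMeasurable
    (ae_of_all _ fun t => ?_)
  rw [add_mul]
  rcases le_total T |t| with ht | ht
  · exact (h t ht).trans ((mul_le_mul_of_nonneg_right (le_abs_self A) (Real.exp_pos _).le).trans
      (le_add_of_nonneg_right (by positivity)))
  · refine (hC t (abs_le.mp ht)).trans ((le_abs_self C).trans ?_)
    rw [mul_assoc |C|, ← Real.exp_add]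
    refine le_trans ?_ (le_add_of_nonneg_left (by positivity))
    refine le_mul_of_one_le_right (abs_nonneg C) (Real.one_le_exp ?_)
    have h1 : t ^ 2 ≤ T ^ 2 := sq_le_sq.mpr (ht.trans (le_abs_self T))
    have h2 : 0 ≤ B * |t| := by positivity
    nlinarith [Real.pi_pos]

theorem dslope_expDiff_zero_ne_zero {w : ℂ} {b : ℝ} (hb : b < 1)
    (h : w.re - w.im ∈ Icc 0 b) : dslope expDiff 0 w ≠ 0 := by
  intro h0
  rcases eq_or_ne w 0 with rfl | hw
  · rw [dslope_same, deriv_expDiff_zero] at h0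
    simp [Real.pi_ne_zero] at h0
  · have h1 := expDiff_eq_sub_mul_dslope (by simpa using expDiff_intCast 0) w
    rw [h0, mul_zero, expDiff_eq_zero_iff] at h1
    obtain ⟨n, rfl⟩ := h1
    simp only [intCast_re, intCast_im, sub_zero] at h
    have h3 : (n : ℝ) < 1 := by linarith [h.2]
    have h2' : 0 ≤ n := by exact_mod_cast h.1
    have h3' : n < 1 := by exact_mod_cast h3
    have : n = 0 := by omega
    simp [this] at hw

/-- The form `integrandR z w dw` on the plane rotated by `-1 - I`. -/
noncomputable def rotatedIntegrandR (z ζ : ℂ) : ℂ :=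
  ((-1 - I) * ζ) ^ (z - 1) * exp (-(2 * Real.pi) * ζ ^ 2) / expDiff ((-1 - I) * ζ) * (-1 - I)

/-- One factor `w` of the power absorbs the simple zero of the denominator at `0`. The remaining
exponent `z - 2` has positive real part, which keeps the integrand continuous at the origin. -/
theorem rotatedIntegrandR_eq {z : ℂ} (hz : 2 < z.re) (ζ : ℂ) :
    rotatedIntegrandR z ζ = ((-1 - I) * ζ) ^ (z - 2) * exp (-(2 * Real.pi) * ζ ^ 2) /
      dslope expDiff 0 ((-1 - I) * ζ) * (-1 - I) := by
  -- At `w = 0` both sides are `0`: the powers vanish, and the quotient `0 / 0` on the left is `0`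
  -- by convention.
  rcases eq_or_ne ((-1 - I) * ζ) 0 with h | h
  · have h1 : z - 1 ≠ 0 := fun h => by
      have := congrArg re h
      simp at this
      linarith
    have h2 : z - 2 ≠ 0 := fun h => by
      have := congrArg re h
      simp at this
      linarith
    rw [rotatedIntegrandR, h, zero_cpow h1, zero_cpow h2]
    simp
  · have h1 := expDiff_eq_sub_mul_dslope (by simpa using expDiff_intCast 0) ((-1 - I) * ζ)
    rw [sub_zero] at h1
    rw [rotatedIntegrandR, h1, show z - 1 = 1 + (z - 2) by ring, cpow_add _ _ h, cpow_one,
      mul_assoc (_ * ζ), mul_div_mul_left _ _ h]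

theorem re_sub_im_neg_one_sub_I_mul (ζ : ℂ) :
    ((-1 - I) * ζ).re - ((-1 - I) * ζ).im = 2 * ζ.im := by
  simp
  ring

theorem neg_one_sub_I_mul_im (t y : ℝ) : ((-1 - I) * ((t : ℂ) + y * I)).im = -(t + y) := by
  simp

/-- On the rotated strip `Re w ≥ Im w`, so it meets the real axis only in `[0, ∞)`: the cut is
avoided except for its endpoint `0`. -/
theorem continuousOn_rotatedIntegrandR {z : ℂ} (hz : 2 < z.re) {b : ℝ} (hb : b < 1) :
    ContinuousOn (rotatedIntegrandR z) {ζ | ζ.im ∈ Icc 0 (b / 2)} := by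
  refine ContinuousOn.congr ?_ fun ζ _ => rotatedIntegrandR_eq hz ζ
  intro ζ hζ
  have h1 : ((-1 - I) * ζ).re - ((-1 - I) * ζ).im ∈ Icc 0 b := by
    rw [re_sub_im_neg_one_sub_I_mul]
    constructor <;> linarith [hζ.1, hζ.2]
  have h2 : 0 ≤ ((-1 - I) * ζ).re ∨ ((-1 - I) * ζ).im ≠ 0 := by
    by_cases h : ((-1 - I) * ζ).im = 0
    · left; rw [h] at h1; linarith [h1.1]
    · exact Or.inr h
  have h3 : ContinuousAt (fun ζ : ℂ => ((-1 - I) * ζ) ^ (z - 2)) ζ :=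
    ContinuousAt.comp (f := fun ζ : ℂ => (-1 - I) * ζ) (g := fun w : ℂ => w ^ (z - 2))
      (continuousAt_cpow_const_of_re_pos h2 (by simpa using hz)) (by fun_prop)
  have h4 : ContinuousAt (fun ζ : ℂ => dslope expDiff 0 ((-1 - I) * ζ)) ζ :=
    ((differentiable_dslope_expDiff 0).continuous.comp (by fun_prop)).continuousAt
  exact (((h3.mul (by fun_prop)).div h4 (dslope_expDiff_zero_ne_zero hb h1)).mul
    continuousAt_const).continuousWithinAt

theorem differentiableAt_rotatedIntegrandR {z : ℂ} (hz : 2 < z.re) {b : ℝ} (hb : b < 1) {ζ : ℂ}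
    (hζ : ζ.im ∈ Ioo 0 (b / 2)) : DifferentiableAt ℂ (rotatedIntegrandR z) ζ := by
  rw [funext (rotatedIntegrandR_eq hz)]
  have h1 : ((-1 - I) * ζ).re - ((-1 - I) * ζ).im ∈ Ioo 0 b := by
    rw [re_sub_im_neg_one_sub_I_mul]
    constructor <;> linarith [hζ.1, hζ.2]
  have h2 : (-1 - I) * ζ ∈ slitPlane := by
    rw [mem_slitPlane_iff]
    by_cases h : ((-1 - I) * ζ).im = 0
    · left; rw [h] at h1; linarith [h1.1]
    · exact Or.inr h
  have h3 : DifferentiableAt ℂ (fun ζ : ℂ => ((-1 - I) * ζ) ^ (z - 2)) ζ :=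
    DifferentiableAt.cpow (by fun_prop) (by fun_prop) h2
  have h4 : DifferentiableAt ℂ (fun ζ : ℂ => dslope expDiff 0 ((-1 - I) * ζ)) ζ :=
    ((differentiable_dslope_expDiff 0).comp (by fun_prop)).differentiableAt
  exact ((h3.mul (by fun_prop)).div h4
    (dslope_expDiff_zero_ne_zero hb (Ioo_subset_Icc_self h1))).mul_const _

theorem exists_norm_rotatedIntegrandR_le (z : ℂ) :
    ∃ A B, 0 ≤ B ∧ ∀ t y : ℝ, 2 ≤ |t| → 0 ≤ y → y ≤ 1 →
      ‖rotatedIntegrandR z (t + y * I)‖ ≤ A * Real.exp (B * |t| - 2 * Real.pi * t ^ 2) := by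
  refine ⟨Real.exp ((2 + Real.pi) * ‖z - 1‖) * Real.exp (2 * Real.pi) * 2,
    2 * ‖z - 1‖, by positivity, fun t y ht hy0 hy1 => ?_⟩
  have him : 1 ≤ |((-1 - I) * ((t : ℂ) + y * I)).im| := by
    rw [neg_one_sub_I_mul_im, abs_neg]
    have := abs_sub_abs_le_abs_sub t (-y)
    rw [abs_neg, abs_of_nonneg hy0, sub_neg_eq_add] at this
    linarith
  have hnorm : 1 ≤ ‖(-1 - I) * ((t : ℂ) + y * I)‖ := him.trans (abs_im_le_norm _)
  have hne : (-1 - I) * ((t : ℂ) + y * I) ≠ 0 := by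
    intro h
    rw [h, norm_zero] at hnorm
    linarith
  have h1 : ‖((-1 - I) * ((t : ℂ) + y * I)) ^ (z - 1)‖ ≤
      Real.exp ((2 * (|t| + 1) + Real.pi) * ‖z - 1‖) := by
    refine (norm_cpow_le_exp hne _).trans (Real.exp_le_exp.mpr ?_)
    refine mul_le_mul_of_nonneg_right ?_ (norm_nonneg _)
    linarith [norm_log_le_of_one_le_norm hnorm,
      norm_mul_add_mul_I_le (t := t) norm_neg_one_sub_I_le hy0 hy1]
  have h2 : ‖(expDiff ((-1 - I) * (t + y * I)))⁻¹‖ ≤ 1 := by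
    rw [norm_inv]
    exact inv_le_one_of_one_le₀ (him.trans (abs_im_le_norm_expDiff _))
  rw [rotatedIntegrandR, div_eq_mul_inv, norm_mul, norm_mul, norm_mul]
  refine (mul_le_mul (mul_le_mul (mul_le_mul h1 (norm_exp_neg_two_pi_sq_le hy0 hy1)
    (norm_nonneg _) (Real.exp_pos _).le) h2 (norm_nonneg _) (by positivity))
    norm_neg_one_sub_I_le (norm_nonneg _) (by positivity)).trans_eq ?_
  rw [show (2 * (|t| + 1) + Real.pi) * ‖z - 1‖ =
    (2 + Real.pi) * ‖z - 1‖ + 2 * ‖z - 1‖ * |t| by ring, Real.exp_add,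
    sub_eq_add_neg (_ * |t|), Real.exp_add]
  ring

theorem pathSW_eq (b t : ℝ) :
    pathSW b t = (-1 - I) * (((t + -(b / 2) : ℝ) : ℂ) + ((b / 2 : ℝ) : ℂ) * I) := by
  rw [pathSW, linePath]
  push_cast
  linear_combination (b / 2 : ℂ) * I_sq

theorem rotatedIntegrandR_add_half (z : ℂ) (b t : ℝ) :
    rotatedIntegrandR z (((t + -(b / 2) : ℝ) : ℂ) + ((b / 2 : ℝ) : ℂ) * I) =
      pullback (integrandR z) (pathSW b) t := by
  rw [rotatedIntegrandR, pullback_integrandR, kernelR, ← pathSW_eq, show -(2 * Real.pi) *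
    (((t + -(b / 2) : ℝ) : ℂ) + ((b / 2 : ℝ) : ℂ) * I) ^ 2 = Real.pi * I * pathSW b t ^ 2 by
      rw [pathSW_eq]
      linear_combination (-Real.pi * (((t + -(b / 2) : ℝ) : ℂ) + ((b / 2 : ℝ) : ℂ) * I) ^ 2 *
        (I + 2)) * I_sq]
  ring

theorem integrable_rotatedIntegrandR {z : ℂ} (hz : 2 < z.re) :
    Integrable fun t : ℝ => rotatedIntegrandR z t := by
  obtain ⟨A, B, hB, hAB⟩ := exists_norm_rotatedIntegrandR_le z
  refine integrable_of_norm_le_exp_abs_sub (A := A) (B := B) (T := 2) ?_ hB fun t ht => ?_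
  · refine (continuousOn_rotatedIntegrandR hz (b := 0) zero_lt_one).comp_continuous
      continuous_ofReal fun t => by simp
  · simpa using hAB t 0 ht le_rfl zero_le_one

theorem contourIntegral_integrandR_eq {z : ℂ} (hz : 2 < z.re) {b : ℝ} (hb : b ∈ Ioo (0 : ℝ) 1) :
    contourIntegral (integrandR z) (pathSW b) = ∫ t : ℝ, rotatedIntegrandR z t := by
  have hint : Integrable fun t : ℝ => rotatedIntegrandR z (t + ((b / 2 : ℝ) : ℂ) * I) := by
    refine ((contourIntegrable_integrandR hb z).comp_add_right (b / 2)).congr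
      (ae_of_all _ fun t => ?_)
    simp only [← rotatedIntegrandR_add_half, add_neg_cancel_right]
  have h := integral_eq_of_strip (h := rotatedIntegrandR z) (y₁ := 0) (y₂ := b / 2)
    (by linarith [hb.1]) (continuousOn_rotatedIntegrandR hz hb.2)
    (fun ζ hζ => differentiableAt_rotatedIntegrandR hz hb.2 hζ) ?_
    (by simpa using integrable_rotatedIntegrandR hz) hint
  · rw [ofReal_zero, zero_mul] at h
    simp only [add_zero] at h
    rw [h, ← integral_add_right_eq_self _ (-(b / 2)), contourIntegral]
    simp_rw [rotatedIntegrandR_add_half]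
  · intro ε hε
    obtain ⟨A, B, -, hAB⟩ := exists_norm_rotatedIntegrandR_le z
    obtain ⟨T₀, hT₂, hT₀⟩ := exists_forall_exp_abs_sub_le A B 2 hε
    exact ⟨T₀, fun t ht y hy => (hAB t y (hT₂.trans ht) hy.1
      (by linarith [hy.2, hb.2])).trans (hT₀ t ht)⟩

/-- The Mellin transform of `e^{π i w²} / (e^{π i w} - e^{-π i w})` along the ray through
`1 + I`. -/
noncomputable def rayIntegral (z : ℂ) : ℂ :=
  ∫ r : ℝ in Ioi 0, (r : ℂ) ^ (z - 1) * (exp (-(2 * Real.pi) * (r : ℂ) ^ 2) /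
    expDiff ((1 + I) * r))

theorem ofReal_mul_cpow {r : ℝ} (hr : 0 < r) {w : ℂ} (hw : w ≠ 0) (s : ℂ) :
    ((r : ℂ) * w) ^ s = (r : ℂ) ^ s * w ^ s := by
  have hr' : (r : ℂ) ≠ 0 := ofReal_ne_zero.mpr hr.ne'
  rw [cpow_def_of_ne_zero (mul_ne_zero hr' hw), cpow_def_of_ne_zero hr', cpow_def_of_ne_zero hw,
    log_ofReal_mul hr hw, ofReal_log hr.le, add_mul, exp_add]

theorem one_add_I_ne_zero : (1 + I) ≠ 0 := fun h => by simpa using congrArg re h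

theorem neg_one_sub_I_ne_zero : (-1 - I) ≠ 0 := fun h => by simpa using congrArg re h

/-- The line through `0` consists of the rays along `-1-i` and `1+i`. The Gaussian is even and
`expDiff` odd, so both give the same ray integral; one minus sign comes from oddness, the other from
traversing the ray along `1+i` inwards. -/
theorem integral_rotatedIntegrandR {z : ℂ} (hz : 2 < z.re) :
    ∫ t : ℝ, rotatedIntegrandR z t = -((-1 - I) ^ z + (1 + I) ^ z) * rayIntegral z := by
  have hint := integrable_rotatedIntegrandR hz
  rw [← intervalIntegral.integral_Iic_add_Ioi hint.integrableOn hint.integrableOn (b := 0),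
    ← neg_zero, ← integral_comp_neg_Ioi]
  simp only [neg_zero]
  have h1 : ∫ t in Ioi (0 : ℝ), rotatedIntegrandR z t = -(-1 - I) ^ z * rayIntegral z := by
    rw [rayIntegral, ← integral_const_mul]
    refine setIntegral_congr_fun measurableSet_Ioi fun t ht => ?_
    rw [rotatedIntegrandR, mul_comm _ (t : ℂ), ofReal_mul_cpow ht neg_one_sub_I_ne_zero,
      show (t : ℂ) * (-1 - I) = -((1 + I) * t) by ring, expDiff_neg,
      cpow_sub z 1 neg_one_sub_I_ne_zero, cpow_one, div_neg]
    have := neg_one_sub_I_ne_zero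
    field_simp
  have h2 : ∫ t in Ioi (0 : ℝ), rotatedIntegrandR z ((-t : ℝ) : ℂ) =
      -(1 + I) ^ z * rayIntegral z := by
    rw [rayIntegral, ← integral_const_mul]
    refine setIntegral_congr_fun measurableSet_Ioi fun t ht => ?_
    rw [rotatedIntegrandR, show (-1 - I) * ((-t : ℝ) : ℂ) = t * (1 + I) by push_cast; ring,
      ofReal_mul_cpow ht one_add_I_ne_zero, cpow_sub z 1 one_add_I_ne_zero, cpow_one,
      mul_comm (t : ℂ) (1 + I), show -1 - I = -(1 + I) by ring]
    have := one_add_I_ne_zero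
    push_cast
    rw [neg_sq]
    field_simp
  rw [h1, h2]
  ring

/-! ### Gamma integrals and Mellin transforms. -/

theorem norm_cpow_mul_exp_neg {t : ℝ} (ht : 0 < t) (a p : ℂ) :
    ‖(t : ℂ) ^ (a - 1) * exp (-(p * t))‖ = t ^ (a.re - 1) * Real.exp (-(p.re * t)) := by
  rw [norm_mul, norm_cpow_eq_rpow_re_of_pos ht, norm_exp]
  simp

theorem integrableOn_rpow_mul_exp_neg {x r : ℝ} (hx : 0 < x) (hr : 0 < r) :
    IntegrableOn (fun t : ℝ => t ^ (x - 1) * Real.exp (-(r * t))) (Ioi 0) := by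
  simpa using integrableOn_rpow_mul_exp_neg_mul_rpow (s := x - 1) (by linarith) one_pos hr

theorem continuousOn_cpow_mul_exp_neg (a p : ℂ) :
    ContinuousOn (fun t : ℝ => (t : ℂ) ^ (a - 1) * exp (-(p * t))) (Ioi 0) := by
  refine ContinuousOn.mul ?_ (by fun_prop)
  exact continuous_ofReal.continuousOn.cpow continuousOn_const fun t ht => Or.inl (by simpa using ht)

theorem integrableOn_cpow_mul_exp_neg {a p : ℂ} (ha : 0 < a.re) (hp : 0 < p.re) :
    IntegrableOn (fun t : ℝ => (t : ℂ) ^ (a - 1) * exp (-(p * t))) (Ioi 0) := by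
  refine (integrableOn_rpow_mul_exp_neg ha hp).mono'
    ((continuousOn_cpow_mul_exp_neg a p).aestronglyMeasurable measurableSet_Ioi)
    ((ae_restrict_mem measurableSet_Ioi).mono fun t ht => ?_)
  exact (norm_cpow_mul_exp_neg ht a p).le

theorem differentiableAt_integral_cpow_mul_exp_neg {a p : ℂ} (ha : 0 < a.re) (hp : 0 < p.re) :
    DifferentiableAt ℂ (fun p : ℂ => ∫ t : ℝ in Ioi 0, (t : ℂ) ^ (a - 1) * exp (-(p * t))) p := by
  have hcont : ContinuousOn (fun t : ℝ => (t : ℂ) ^ (a - 1) * (exp (-(p * t)) * -(1 * t)))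
      (Ioi 0) := by
    simp only [← mul_assoc]
    exact (continuousOn_cpow_mul_exp_neg a p).mul (by fun_prop)
  refine (hasDerivAt_integral_of_dominated_loc_of_deriv_le (s := {q : ℂ | p.re / 2 < q.re})
    -- Differentiating in `p` brings down a factor `t`, hence the exponent raised by one; half the
    -- decay rate survives for all nearby `q`.
    (bound := fun t : ℝ => t ^ ((a.re + 1) - 1) * Real.exp (-(p.re / 2 * t)))
    (F := fun (p : ℂ) (t : ℝ) => (t : ℂ) ^ (a - 1) * exp (-(p * t)))
    (F' := fun (p : ℂ) (t : ℝ) => (t : ℂ) ^ (a - 1) * (exp (-(p * t)) * -(1 * t)))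
    ((isOpen_lt continuous_const continuous_re).mem_nhds (by simpa using hp))
    (Eventually.of_forall fun q =>
      (continuousOn_cpow_mul_exp_neg a q).aestronglyMeasurable measurableSet_Ioi)
    (integrableOn_cpow_mul_exp_neg ha hp) (hcont.aestronglyMeasurable measurableSet_Ioi)
    ((ae_restrict_mem measurableSet_Ioi).mono fun t ht q hq => ?_)
    (integrableOn_rpow_mul_exp_neg (by linarith) (by linarith))
    (ae_of_all _ fun t q _ => ?_)).2.differentiableAt
  · have ht' : 0 < t := ht
    have hq' : p.re / 2 < q.re := hq
    rw [← mul_assoc, norm_mul, norm_cpow_mul_exp_neg ht, one_mul, norm_neg, norm_real,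
      Real.norm_of_nonneg ht'.le, add_sub_cancel_right]
    have h1 : t ^ a.re = t ^ (a.re - 1) * t := by
      rw [← Real.rpow_add_one ht'.ne', sub_add_cancel]
    rw [h1, mul_right_comm]
    refine mul_le_mul_of_nonneg_left (Real.exp_le_exp.mpr ?_) (by positivity)
    nlinarith
  · exact (((hasDerivAt_id q).mul_const (t : ℂ)).neg.cexp).const_mul _

/-- Both sides are holomorphic in `p` on the right half-plane and agree for real `p > 1`, so the
identity theorem applies. -/
theorem integral_cpow_mul_exp_neg {a p : ℂ} (ha : 0 < a.re) (hp : 0 < p.re) :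
    ∫ t : ℝ in Ioi 0, (t : ℂ) ^ (a - 1) * exp (-(p * t)) = p ^ (-a) * Gamma a := by
  have hopen : IsOpen {q : ℂ | 0 < q.re} := isOpen_lt continuous_const continuous_re
  have h1 : AnalyticOnNhd ℂ
      (fun p : ℂ => ∫ t : ℝ in Ioi 0, (t : ℂ) ^ (a - 1) * exp (-(p * t))) {q : ℂ | 0 < q.re} :=
    DifferentiableOn.analyticOnNhd (fun q hq =>
      (differentiableAt_integral_cpow_mul_exp_neg ha hq).differentiableWithinAt) hopen
  have h2 : AnalyticOnNhd ℂ (fun p : ℂ => p ^ (-a) * Gamma a) {q : ℂ | 0 < q.re} :=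
    DifferentiableOn.analyticOnNhd (fun q hq => ((differentiableAt_id.cpow_const
      (Or.inl hq)).mul_const _).differentiableWithinAt) hopen
  refine AnalyticOnNhd.eqOn_of_preconnected_of_frequently_eq h1 h2
    (convex_halfSpace_re_gt 0).isPreconnected (z₀ := 1) (by simp) ?_ hp
  have hlim : Tendsto (fun x : ℝ => (x : ℂ)) (𝓝[>] 1) (𝓝[≠] 1) := by
    refine tendsto_nhdsWithin_iff.mpr ⟨?_, ?_⟩
    · simpa using (continuous_ofReal.tendsto (1 : ℝ)).mono_left nhdsWithin_le_nhds
    · filter_upwards [self_mem_nhdsWithin] with x hx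
      have : x ≠ 1 := (show (1 : ℝ) < x from hx).ne'
      simpa using this
  refine hlim.frequently (Eventually.frequently ?_)
  filter_upwards [self_mem_nhdsWithin] with x hx
  have hx0 : 0 < x := zero_lt_one.trans hx
  rw [integral_cpow_mul_exp_neg_mul_Ioi ha hx0, one_div, cpow_neg, inv_cpow]
  rw [arg_ofReal_of_nonneg hx0.le]
  exact Real.pi_ne_zero.symm

theorem mul_cpow_of_arg {x y : ℂ} (hx : x ≠ 0) (hy : y ≠ 0)
    (h : x.arg + y.arg ∈ Ioc (-Real.pi) Real.pi) (s : ℂ) : (x * y) ^ s = x ^ s * y ^ s := by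
  rw [cpow_def_of_ne_zero (mul_ne_zero hx hy), cpow_def_of_ne_zero hx, cpow_def_of_ne_zero hy,
    (log_mul_eq_add_log_iff hx hy).mpr h, add_mul, exp_add]

theorem abs_arg_lt_of_re_pos {x : ℂ} (hx : 0 < x.re) : |x.arg| < Real.pi / 2 :=
  abs_arg_lt_pi_div_two_iff.mpr (Or.inl hx)

theorem ne_zero_of_zero_lt_re {x : ℂ} (hx : 0 < x.re) : x ≠ 0 := fun h => by simp [h] at hx

theorem mul_cpow_of_re_pos {x y : ℂ} (hx : 0 < x.re) (hy : 0 < y.re) (s : ℂ) :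
    (x * y) ^ s = x ^ s * y ^ s := by
  have h1 := abs_lt.mp (abs_arg_lt_of_re_pos hx)
  have h2 := abs_lt.mp (abs_arg_lt_of_re_pos hy)
  exact mul_cpow_of_arg (ne_zero_of_zero_lt_re hx) (ne_zero_of_zero_lt_re hy)
    ⟨by linarith [h1.1, h2.1], by linarith [h1.2, h2.2]⟩ s

/-- Here `w` may lie outside the right half-plane, but `x⁻¹` and `x * w` do not, and `w` is their
product. -/
theorem mul_cpow_of_re_pos_of_mul_re_pos {x w : ℂ} (hx : 0 < x.re) (hxw : 0 < (x * w).re) (s : ℂ) :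
    (x * w) ^ s = x ^ s * w ^ s := by
  have hx0 := ne_zero_of_zero_lt_re hx
  have hinv : 0 < x⁻¹.re := by
    rw [inv_re]
    exact div_pos hx (normSq_pos.mpr hx0)
  have h1 := mul_cpow_of_re_pos hinv hxw s
  have h2 := mul_cpow_of_re_pos hx hinv s
  rw [inv_mul_cancel_left₀ hx0] at h1
  rw [mul_inv_cancel₀ hx0, one_cpow] at h2
  rw [h1, ← mul_assoc, ← h2, one_mul]

theorem two_pi_mul_one_sub_I_re : (2 * Real.pi * (1 - I)).re = 2 * Real.pi := by simp

theorem integrable_kernelL {a : ℝ} (ha : a ∈ Ioo (0 : ℝ) 1) : Integrable (kernelL a) := by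
  simpa using integrable_exp_mul_kernelL ha 0

/-- Because `(1 - i)² = -2i`, moving along the contour changes only the phase. The modulus is
independent of `t`, so integrability for Fubini reduces to that of a product. -/
theorem exp_neg_mul_pathSE (a t r : ℝ) :
    exp (-(2 * Real.pi * (1 - I) * pathSE a t * r)) =
      exp (-(2 * Real.pi * a * (1 - I) * r)) * exp ((4 * Real.pi * (t * r) : ℝ) * I) := by
  rw [← exp_add, pathSE, linePath]
  congr 1
  push_cast
  linear_combination (-2 * Real.pi * t * r) * I_sq

theorem integrable_kernelL_mul_cpow_mul_exp {a : ℝ} (ha : a ∈ Ioo (0 : ℝ) 1) {z : ℂ}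
    (hz : 0 < z.re) :
    Integrable (Function.uncurry fun t r : ℝ => kernelL a t *
      ((r : ℂ) ^ (z - 1) * exp (-(2 * Real.pi * (1 - I) * pathSE a t * r))))
      (volume.prod (volume.restrict (Ioi 0))) := by
  have h := (integrable_kernelL ha).mul_prod (integrableOn_cpow_mul_exp_neg (a := z)
    (p := 2 * Real.pi * a * (1 - I)) hz (by simpa using mul_pos Real.two_pi_pos ha.1))
  have hphase : Continuous fun x : ℝ × ℝ => exp ((4 * Real.pi * (x.1 * x.2) : ℝ) * I) := by
    fun_prop
  have heq : (Function.uncurry fun t r : ℝ => kernelL a t *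
      ((r : ℂ) ^ (z - 1) * exp (-(2 * Real.pi * (1 - I) * pathSE a t * r)))) = fun x : ℝ × ℝ =>
      (kernelL a x.1 * ((x.2 : ℂ) ^ (z - 1) * exp (-(2 * Real.pi * a * (1 - I) * x.2)))) *
        exp ((4 * Real.pi * (x.1 * x.2) : ℝ) * I) := by
    ext ⟨t, r⟩
    simp only [Function.uncurry, exp_neg_mul_pathSE]
    ring
  rw [heq]
  refine h.mono (h.aestronglyMeasurable.mul hphase.aestronglyMeasurable) (ae_of_all _ fun x => ?_)
  rw [norm_mul, norm_exp_ofReal_mul_I, mul_one]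

theorem integral_kernelL_mul_cpow_mul_exp (a : ℝ) (z : ℂ) (r : ℝ) :
    ∫ t : ℝ, kernelL a t * ((r : ℂ) ^ (z - 1) *
      exp (-(2 * Real.pi * (1 - I) * pathSE a t * r))) =
      (r : ℂ) ^ (z - 1) * mordellIntegral a ((1 + I) * r) := by
  rw [mordellIntegral, ← integral_const_mul]
  congr 1
  ext t
  rw [show 2 * Real.pi * I * ((1 + I) * r) * pathSE a t =
    -(2 * Real.pi * (1 - I) * pathSE a t * r) by
      linear_combination (2 * Real.pi * r * pathSE a t) * I_sq]
  ring

theorem integrableOn_cpow_mul_mordellIntegral {a : ℝ} (ha : a ∈ Ioo (0 : ℝ) 1) {z : ℂ}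
    (hz : 0 < z.re) :
    IntegrableOn (fun r : ℝ => (r : ℂ) ^ (z - 1) * mordellIntegral a ((1 + I) * r)) (Ioi 0) := by
  refine (integrable_kernelL_mul_cpow_mul_exp ha hz).integral_prod_right.congr
    (ae_of_all _ fun r => ?_)
  exact integral_kernelL_mul_cpow_mul_exp a z r

/-- After Fubini the inner integral is a Gamma integral with `p = 2π(1-i)w`, whose real part is `2πa
> 0` on the whole contour; it produces the power `w^{-z}`. -/
theorem integral_cpow_mul_mordellIntegral {a : ℝ} (ha : a ∈ Ioo (0 : ℝ) 1) {z : ℂ}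
    (hz : 0 < z.re) :
    ∫ r : ℝ in Ioi 0, (r : ℂ) ^ (z - 1) * mordellIntegral a ((1 + I) * r) =
      (2 * Real.pi * (1 - I)) ^ (-z) * Gamma z * contourIntegral (integrandL z) (pathSE a) := by
  simp_rw [← integral_kernelL_mul_cpow_mul_exp]
  rw [← integral_integral_swap (integrable_kernelL_mul_cpow_mul_exp ha hz), contourIntegral,
    ← integral_const_mul]
  congr 1
  ext t
  have hre : (2 * Real.pi * (1 - I) * pathSE a t).re = 2 * Real.pi * a := by
    simp [pathSE, linePath]
    ring
  have hpos : 0 < (2 * Real.pi * (1 - I) * pathSE a t).re := by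
    rw [hre]
    exact mul_pos Real.two_pi_pos ha.1
  rw [integral_const_mul, integral_cpow_mul_exp_neg hz hpos, pullback_integrandL,
    mul_cpow_of_re_pos_of_mul_re_pos (by rw [two_pi_mul_one_sub_I_re]; exact Real.two_pi_pos) hpos]
  ring

theorem hasSum_exp_neg_succ_mul {p : ℂ} {r : ℝ} (hp : 0 < p.re) (hr : 0 < r) :
    HasSum (fun n : ℕ => exp (-(((n + 1 : ℝ) : ℂ) * p * r))) (1 / (exp (p * r) - 1)) := by
  have h1 : ‖exp (-(p * r))‖ < 1 := by
    rw [norm_exp, Real.exp_lt_one_iff]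
    simpa using mul_pos hp hr
  have h2 := (hasSum_geometric_of_norm_lt_one h1).mul_left (exp (-(p * r)))
  have hterm : (fun n : ℕ => exp (-(((n + 1 : ℝ) : ℂ) * p * r))) =
      fun n : ℕ => exp (-(p * r)) * exp (-(p * r)) ^ n := by
    ext n
    rw [← exp_nat_mul, ← exp_add]
    push_cast
    ring_nf
  have hval : 1 / (exp (p * r) - 1) = exp (-(p * r)) * (1 - exp (-(p * r)))⁻¹ := by
    have h3 : 1 - exp (-(p * r)) ≠ 0 := by
      intro h
      rw [← sub_eq_zero.mp h, norm_one] at h1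
      exact lt_irrefl _ h1
    have h4 : exp (p * r) - 1 = exp (p * r) * (1 - exp (-(p * r))) := by
      rw [mul_sub, ← exp_add, add_neg_cancel, exp_zero, mul_one]
    rw [h4, exp_neg]
    have := exp_ne_zero (p * r)
    rw [exp_neg] at h3
    field_simp
  rw [hterm, hval]
  exact h2

/-- Expansion in a geometric series and termwise integration, as in Riemann's integral for `ζ`, with
`p` allowed to be complex. -/
theorem integral_cpow_div_exp_sub_one {z p : ℂ} (hz : 1 < z.re) (hp : 0 < p.re) :
    ∫ r : ℝ in Ioi 0, (r : ℂ) ^ (z - 1) * (1 / (exp (p * r) - 1)) =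
      p ^ (-z) * Gamma z * riemannZeta z := by
  have hz0 : 0 < z.re := zero_lt_one.trans hz
  have hpn : ∀ n : ℕ, 0 < (((n + 1 : ℝ) : ℂ) * p).re := fun n => by
    rw [re_ofReal_mul]
    positivity
  have hsum := hasSum_integral_of_summable_integral_norm
    (F := fun (n : ℕ) (r : ℝ) => (r : ℂ) ^ (z - 1) * exp (-(((n + 1 : ℝ) : ℂ) * p * r)))
    (μ := volume.restrict (Ioi 0)) (fun n => integrableOn_cpow_mul_exp_neg hz0 (hpn n)) ?_
  · have hint : ∫ r : ℝ in Ioi 0, (r : ℂ) ^ (z - 1) * (1 / (exp (p * r) - 1)) =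
        ∫ r : ℝ in Ioi 0, ∑' n : ℕ, (r : ℂ) ^ (z - 1) * exp (-(((n + 1 : ℝ) : ℂ) * p * r)) :=
      setIntegral_congr_fun measurableSet_Ioi fun r hr =>
        ((hasSum_exp_neg_succ_mul hp hr).mul_left _).tsum_eq.symm
    rw [hint, ← hsum.tsum_eq, zeta_eq_tsum_one_div_nat_add_one_cpow hz, ← tsum_mul_left]
    congr 1
    ext n
    rw [integral_cpow_mul_exp_neg hz0 (hpn n),
      ofReal_mul_cpow (by positivity) (ne_zero_of_zero_lt_re hp), cpow_neg ((n + 1 : ℝ) : ℂ)]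
    push_cast
    ring
  · have hval : ∀ n : ℕ, ∫ r : ℝ in Ioi 0,
        ‖(r : ℂ) ^ (z - 1) * exp (-(((n + 1 : ℝ) : ℂ) * p * r))‖ =
        1 / ((n + 1 : ℕ) : ℝ) ^ z.re * ((1 / p.re) ^ z.re * Real.Gamma z.re) := by
      intro n
      rw [setIntegral_congr_fun measurableSet_Ioi fun r hr => norm_cpow_mul_exp_neg hr z _,
        Real.integral_rpow_mul_exp_neg_mul_Ioi hz0 (hpn n), re_ofReal_mul, ← mul_assoc,
        one_div, mul_inv, Real.mul_rpow (by positivity) (by positivity),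
        Real.inv_rpow (by positivity)]
      push_cast
      simp only [one_div]
    simp_rw [hval]
    exact ((summable_nat_add_iff 1).mpr (Real.summable_one_div_nat_rpow.mpr hz)).mul_right _

theorem integrableOn_rayIntegrand {z : ℂ} (hz : 2 < z.re) :
    IntegrableOn (fun r : ℝ => (r : ℂ) ^ (z - 1) * (exp (-(2 * Real.pi) * (r : ℂ) ^ 2) /
      expDiff ((1 + I) * r))) (Ioi 0) := by
  refine (((integrable_rotatedIntegrandR hz).integrableOn (s := Ioi 0)).const_mul
    (-((-1 - I) ^ z)⁻¹)).congr ((ae_restrict_mem measurableSet_Ioi).mono fun t ht => ?_)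
  have h0 : (-1 - I) ^ z ≠ 0 := by simp [cpow_eq_zero_iff, neg_one_sub_I_ne_zero]
  have := neg_one_sub_I_ne_zero
  simp only
  rw [rotatedIntegrandR, mul_comm _ (t : ℂ), ofReal_mul_cpow ht neg_one_sub_I_ne_zero,
    show (t : ℂ) * (-1 - I) = -((1 + I) * t) by ring, expDiff_neg,
    cpow_sub z 1 neg_one_sub_I_ne_zero, cpow_one, div_neg]
  field_simp

/-! ### The relation for `Re z > 2`, its continuation, and the symmetric form. -/

theorem mellin_decomposition {a : ℝ} (ha : a ∈ Ioo (0 : ℝ) 1) {z : ℂ} (hz : 2 < z.re) :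
    (2 * Real.pi * (1 - I)) ^ (-z) * Gamma z * contourIntegral (integrandL z) (pathSE a) =
      (2 * Real.pi * (1 - I)) ^ (-z) * Gamma z * riemannZeta z + rayIntegral z := by
  have hz0 : 0 < z.re := by linarith
  rw [← integral_cpow_mul_mordellIntegral ha hz0, ← integral_cpow_div_exp_sub_one (by linarith)
    (by rw [two_pi_mul_one_sub_I_re]; exact Real.two_pi_pos), ← sub_eq_iff_eq_add, rayIntegral,
    ← integral_sub (integrableOn_cpow_mul_mordellIntegral ha hz0) (integrableOn_rayIntegrand hz)]
  refine setIntegral_congr_fun measurableSet_Ioi fun r hr => ?_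
  have hexp : -(2 * Real.pi * I * ((1 + I) * r)) = 2 * Real.pi * (1 - I) * r := by
    linear_combination (-2 * Real.pi * r) * I_sq
  -- Its modulus is `e^{-2πr}`, less than `1`.
  have hne : exp (2 * Real.pi * I * ((1 + I) * r)) ≠ 1 := by
    intro h
    have h1 := congrArg norm h
    rw [norm_exp, norm_one, Real.exp_eq_one_iff, ← neg_eq_zero, ← neg_re, hexp] at h1
    have h2 : 0 < 2 * Real.pi * r := mul_pos Real.two_pi_pos hr
    simp at h1
    simp_all
  rw [mordellIntegral_eq ha hne, hexp, show Real.pi * I * ((1 + I) * r) ^ 2 =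
    -(2 * Real.pi) * (r : ℂ) ^ 2 by
      linear_combination (Real.pi * (r : ℂ) ^ 2 * (I + 2)) * I_sq]
  ring

/-- Since `1 + i = (1 - i)i` and `-1 - i = (1 - i)(-i)`, with arguments adding up inside `(-π, π)`,
the principal powers factor, leaving `i^z + (-i)^z`. -/
theorem cpow_add_cpow_eq_cos (z : ℂ) :
    (-1 - I) ^ z + (1 + I) ^ z = 2 * cos (Real.pi * z / 2) * (1 - I) ^ z := by
  have hre : 0 < (1 - I).re := by simp
  have h0 := ne_zero_of_zero_lt_re hre
  have harg := abs_lt.mp (abs_arg_lt_of_re_pos hre)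
  have h1 : (1 + I) ^ z = (1 - I) ^ z * I ^ z := by
    rw [← mul_cpow_of_arg h0 I_ne_zero]
    · congr 1
      linear_combination I_sq
    · rw [arg_I]
      constructor <;> linarith [harg.1, harg.2]
  have h2 : (-1 - I) ^ z = (1 - I) ^ z * (-I) ^ z := by
    rw [← mul_cpow_of_arg h0 (neg_ne_zero.mpr I_ne_zero)]
    · congr 1
      linear_combination -I_sq
    · rw [arg_neg_I]
      constructor <;> linarith [harg.1, harg.2]
  rw [h1, h2, cpow_def_of_ne_zero I_ne_zero, cpow_def_of_ne_zero (neg_ne_zero.mpr I_ne_zero),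
    log_I, log_neg_I, cos]
  ring_nf

theorem contourIntegral_relation_of_two_lt_re {a b : ℝ} (ha : a ∈ Ioo (0 : ℝ) 1)
    (hb : b ∈ Ioo (0 : ℝ) 1) {z : ℂ} (hz : 2 < z.re) :
    (2 * Real.pi) ^ z * (Gamma z)⁻¹ * contourIntegral (integrandR z) (pathSW b) =
      2 * cos (Real.pi * z / 2) *
        (riemannZeta z - contourIntegral (integrandL z) (pathSE a)) := by
  have h := mellin_decomposition ha hz
  have hΓ : Gamma z ≠ 0 := Gamma_ne_zero_of_re_pos (by linarith)
  have hre : 0 < (1 - I).re := by simp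
  have hsplit : (2 * Real.pi * (1 - I)) ^ (-z) = ((2 * Real.pi : ℂ) ^ z)⁻¹ * ((1 - I) ^ z)⁻¹ := by
    have := ofReal_mul_cpow Real.two_pi_pos (ne_zero_of_zero_lt_re hre) (-z)
    push_cast at this
    rw [this, cpow_neg, cpow_neg]
  have hA : (2 * Real.pi : ℂ) ^ z ≠ 0 := by simp [cpow_eq_zero_iff, Real.pi_ne_zero]
  have hB : (1 - I) ^ z ≠ 0 := by simp [cpow_eq_zero_iff, ne_zero_of_zero_lt_re hre]
  rw [contourIntegral_integrandR_eq hz hb, integral_rotatedIntegrandR hz, cpow_add_cpow_eq_cos]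
  rw [hsplit] at h
  have hray : rayIntegral z = ((2 * Real.pi : ℂ) ^ z)⁻¹ * ((1 - I) ^ z)⁻¹ * Gamma z *
      (contourIntegral (integrandL z) (pathSE a) - riemannZeta z) := by
    linear_combination -h
  rw [hray]
  field_simp
  ring

/-- Analytic continuation over the connected set `{1}ᶜ`. Writing the relation with `(Gamma z)⁻¹`, an
entire function, leaves the pole of `ζ` as the only exception. -/
theorem contourIntegral_relation {a b : ℝ} (ha : a ∈ Ioo (0 : ℝ) 1) (hb : b ∈ Ioo (0 : ℝ) 1)
    {z : ℂ} (hz : z ≠ 1) :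
    (2 * Real.pi) ^ z * (Gamma z)⁻¹ * contourIntegral (integrandR z) (pathSW b) =
      2 * cos (Real.pi * z / 2) *
        (riemannZeta z - contourIntegral (integrandL z) (pathSE a)) := by
  have h2pi : (2 * Real.pi : ℂ) ≠ 0 := by simp [Real.pi_ne_zero]
  have h1 : AnalyticOnNhd ℂ (fun z : ℂ => (2 * Real.pi : ℂ) ^ z * (Gamma z)⁻¹ *
      contourIntegral (integrandR z) (pathSW b)) {1}ᶜ := by
    refine DifferentiableOn.analyticOnNhd (Differentiable.differentiableOn ?_)
      isOpen_compl_singleton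
    exact ((differentiable_id.const_cpow (Or.inl h2pi)).mul differentiable_one_div_Gamma).mul
      (differentiable_contourIntegral_integrandR hb)
  have h2 : AnalyticOnNhd ℂ (fun z : ℂ => 2 * cos (Real.pi * z / 2) *
      (riemannZeta z - contourIntegral (integrandL z) (pathSE a))) {1}ᶜ := by
    refine DifferentiableOn.analyticOnNhd (DifferentiableOn.mul ?_ ?_) isOpen_compl_singleton
    · exact Differentiable.differentiableOn (by fun_prop)
    · exact differentiableOn_riemannZeta.sub
        (differentiable_contourIntegral_integrandL ha).differentiableOn
  refine AnalyticOnNhd.eqOn_of_preconnected_of_eventuallyEq h1 h2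
    (isConnected_compl_singleton_of_one_lt_rank (by simp) 1).isPreconnected
    (z₀ := 3) (by simp) ?_ hz
  filter_upwards [(isOpen_lt continuous_const continuous_re).mem_nhds
    (show (2 : ℝ) < (3 : ℂ).re by norm_num)] with z hz'
  exact contourIntegral_relation_of_two_lt_re ha hb hz'

theorem mainTheorem2 (z : ℂ) (hz0 : 0 < z.re) (hz1 : z.re < 1)
    (a b : ℝ) (ha : a ∈ Set.Ioo (0 : ℝ) 1) (hb : b ∈ Set.Ioo (0 : ℝ) 1) :
    ContourIntegrable (integrandL z) (pathSE a) ∧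
    ContourIntegrable (integrandR z) (pathSW b) ∧
    completedZeta z = zetaL a z + zetaR b z := by
  refine ⟨contourIntegrable_integrandL ha z, contourIntegrable_integrandR hb z, ?_⟩
  have hne : z ≠ 1 := by
    rintro rfl
    simp at hz1
  have hrel := contourIntegral_relation ha hb hne
  have hinv : (1 - z).Gammaℝ⁻¹ = z.Gammaℂ * cos (Real.pi * z / 2) * z.Gammaℝ⁻¹ := by
    refine inv_Gammaℝ_one_sub fun n hn => ?_
    rw [hn] at hz0
    simp at hz0
    linarith [n.cast_nonneg (α := ℝ)]
  have hR : z.Gammaℝ ≠ 0 := Gammaℝ_ne_zero_of_re_pos hz0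
  have hR' : (1 - z).Gammaℝ ≠ 0 := Gammaℝ_ne_zero_of_re_pos (by simpa using hz1)
  have hΓ : Gamma z ≠ 0 := Gamma_ne_zero_of_re_pos hz0
  have hpow : (2 * Real.pi : ℂ) ^ z ≠ 0 := by simp [cpow_eq_zero_iff, Real.pi_ne_zero]
  have hrel' : contourIntegral (integrandR z) (pathSW b) = z.Gammaℂ * cos (Real.pi * z / 2) *
      (riemannZeta z - contourIntegral (integrandL z) (pathSE a)) := by
    rw [Gammaℂ_def, cpow_neg]
    field_simp at hrel ⊢
    linear_combination hrel
  -- This Gamma identity turns the prefactor of the right integral into that of `ζ(z)`, so the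
  -- second term becomes `Gammaℝ z` times `ζ(z)` minus the left integral.
  have hone : (1 - z).Gammaℝ * (z.Gammaℂ * cos (Real.pi * z / 2)) = z.Gammaℝ := by
    generalize cos (Real.pi * z / 2) = c at hinv ⊢
    field_simp at hinv
    linear_combination -hinv
  rw [completedZeta, zetaL, zetaR, ← Gammaℝ_def, ← Gammaℝ_def, hrel']
  linear_combination -(riemannZeta z - contourIntegral (integrandL z) (pathSE a)) * hone
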